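/- Let $(\mathcal M,Q)$ be a Lie 2-algebroid over a smooth manifold $M$: a $[2]$-manifold $\mathcal M$ over $M$ with graded algebra of functions $C^\infty(\mathcal M)$ and a homological vector field $Q$ (a graded derivation of degree $1$ with $Q^2=0$). A splitting $S$ of $\mathcal M$ is an isomorphism $\mathcal M\simeq Q[1]\oplus B^*[2]$ over $\mathrm{id}_M$, with vector bundles $Q$ and $B^*$ over $M$, i.e. an isomorphism of graded $C^\infty(M)$-algebras $\Gamma(\wedge Q^*\otimes S B)\cong C^\infty(\mathcal M)$ with $\Gamma(Q^*)$ in degree $1$ and $\Gamma(B)$ in degree $2$. Given a splitting $S$ and $TM$-connections $\nabla$ on $Q$ and on $B^*$, let $$\mu_\nabla\colon C^\infty(\mathcal M)\otimes\Gamma(TM[0]\oplus Q[1]\oplus B^*[2])\to\mathfrak X(\mathcal M)$$ be the $C^\infty(\mathcal M)$-linear map to the module of vector fields (spanned by the homogeneous graded derivations of $C^\infty(\mathcal M)$) that sends $\beta\in\Gamma(B^*)$ to the vector field $\hat\beta$ with $\hat\beta(b)=\langle\beta,b\rangle$, $\hat\beta|_{\Gamma(\wedge Q^*)}=0$, sends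 $q\in\Gamma(Q)$ to $\hat q$ with $\hat q(\tau)=\langle q,\tau\rangle$, $\hat q|_{\Gamma(SB)}=0$, and sends $X\in\mathfrak X(M)$ to the vector field $\nabla_X$ of degree $0$ induced by the (dual) connections on $Q^*$ and $B$. An adjoint representation is a representation up to homotopy (left differential graded module) $\mathrm{ad}_\nabla=(C^\infty(\mathcal M)\otimes\Gamma(TM[0]\oplus Q[1]\oplus B^*[2]),\mathcal D)$ with $\mu_\nabla\circ\mathcal D=[Q,\cdot\,]\circ\mu_\nabla$, where $[\cdot,\cdot]$ is the graded commutator. 1. The map $\mu_\nabla$ is a degree-preserving isomorphism. Hence $S$ and $\nabla$ determine exactly one adjoint representation $\mathrm{ad}_\nabla$. 2. Let $S_1,S_2$ be two splittings onto the same $Q[1]\oplus B^*[2]$ with change of splitting $\sigma\in\Omega^2(Q,B^*)$: the isomorphism $S_2^{-1}\circ S_1$ of $\Gamma(\wedge Q^*\otimes SB)$ sends $\tau\mapsto\tau$ for $\tau\in\Gamma(Q^*)$ and $b\mapsto b+\langle\sigma,b\rangle$ for $b\in\Gamma(B)$. Fix $TM$-connections $\nabla$ on $Q$ and $B^*$,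 and let $\mathrm{ad}^1_\nabla,\mathrm{ad}^2_\nabla$ be the adjoint representations for $S_1,S_2$ with these same connections. Then the $C^\infty(\mathcal M)$-linear map $\mu=\mathrm{id}\oplus\sigma\oplus\nabla_\cdot\sigma$ with $$\beta\mapsto\beta,\qquad q\mapsto q+\sigma(q,\cdot),\qquad X\mapsto X+\nabla_X\sigma$$ is an isomorphism of representations up to homotopy $\mathrm{ad}^2_\nabla\to\mathrm{ad}^1_\nabla$. Its inverse $\mathrm{ad}^1_\nabla\to\mathrm{ad}^2_\nabla$ is the map of the same form for $-\sigma$, $$\beta\mapsto\beta,\qquad q\mapsto q-\sigma(q,\cdot),\qquad X\mapsto X-\nabla_X\sigma,$$ and equals the composition of $\mu_\nabla$ for $S_1$, $\mathrm{ad}^1_\nabla\to\mathfrak X(\mathcal M)$, with the inverse of $\mu_\nabla$ for $S_2$, $\mathfrak X(\mathcal M)\to\mathrm{ad}^2_\nabla$. 3. The adjoint representations obtained from any two splittings (possibly onto different vector bundles) and any $TM$-connections are isomorphic as representations up to homotopy; thus the adjoint representation of $(\mathcal M,Q)$ is well defined up to isomorphism. -/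

import Mathlib

open Bundle
open scoped TensorProduct Manifold ContDiff Bundle

noncomputable section

namespace LieTwo

/-! ### Derivations of modules covering a derivation of the base ring -/

section Covering

variable {R : Type*} [CommRing R] [Algebra ℝ R]

/-- An additive operator `D` on an `R`-module covering the derivation `X` of `R`:
`D (r m) = X(r) m + r D m`. -/
structure Covering (X : Derivation ℝ R R) (G : Type*) [AddCommGroup G] [Module R G] where
  toFun : G →+ G
  leibniz : ∀ (r : R) (g : G), toFun (r • g) = X r • g + r • toFun g

/-- A linear connection on an `R`-module `G`.  For `R = C^∞(M)`, vector fields on `M` are the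
derivations of `C^∞(M)`, and for `G = Γ(E)` this is a `TM`-connection on `E`. -/
structure Connection (R : Type*) [CommRing R] [Algebra ℝ R]
    (G : Type*) [AddCommGroup G] [Module R G] where
  cov : (X : Derivation ℝ R R) → Covering X G
  add_left : ∀ X Y g, (cov (X + Y)).toFun g = (cov X).toFun g + (cov Y).toFun g
  smul_left : ∀ (r : R) X g, (cov (r • X)).toFun g = r • (cov X).toFun g

variable {X : Derivation ℝ R R}
variable {G : Type*} [AddCommGroup G] [Module R G] {H : Type*} [AddCommGroup H] [Module R H]

/-- The dual operator: `⟨D^* τ, g⟩ = X ⟨τ, g⟩ - ⟨τ, D g⟩`. -/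
def Covering.dual (D : Covering X G) : Covering X (Module.Dual R G) where
  toFun :=
    { toFun := fun τ =>
        { toFun := fun g => X (τ g) - τ (D.toFun g)
          map_add' := by intro a b; simp only [map_add]; ring
          map_smul' := by
            intro r a
            simp only [D.leibniz, map_smul, map_add, smul_eq_mul, Derivation.leibniz,
              RingHom.id_apply]
            ring }
      map_zero' := by ext; simp
      map_add' := by
        intro a b; ext g
        simp only [LinearMap.add_apply, map_add, LinearMap.coe_mk, AddHom.coe_mk]; ring }
  leibniz := by
    intro r τ; ext g
    simp only [AddMonoidHom.coe_mk, ZeroHom.coe_mk, LinearMap.coe_mk, AddHom.coe_mk,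
      LinearMap.add_apply, LinearMap.smul_apply, smul_eq_mul, Derivation.leibniz]
    ring

/-- The operator on a tensor product: `D (g ⊗ h) = D g ⊗ h + g ⊗ D h`. -/
def Covering.tensor (D : Covering X G) (D' : Covering X H) : Covering X (G ⊗[R] H) where
  toFun := TensorProduct.liftAddHom
    { toFun := fun g =>
        { toFun := fun h => D.toFun g ⊗ₜ[R] h + g ⊗ₜ[R] D'.toFun h
          map_zero' := by simp
          map_add' := by
            intro a b; simp only [map_add, TensorProduct.tmul_add]; abel }
      map_zero' := by ext; simp
      map_add' := by
        intro a b; ext h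
        simp only [map_add, TensorProduct.add_tmul, AddMonoidHom.coe_mk, ZeroHom.coe_mk,
          AddMonoidHom.add_apply]; abel }
    (by
      intro r g h
      simp only [AddMonoidHom.coe_mk, ZeroHom.coe_mk, D.leibniz, D'.leibniz,
        TensorProduct.add_tmul, TensorProduct.tmul_add, TensorProduct.smul_tmul]
      abel)
  leibniz := by
    intro r x
    induction x using TensorProduct.induction_on with
    | zero => simp
    | tmul g h =>
      simp only [TensorProduct.smul_tmul', TensorProduct.liftAddHom_tmul, AddMonoidHom.coe_mk,
        ZeroHom.coe_mk, D.leibniz, TensorProduct.add_tmul, smul_add]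
      abel
    | add a b ha hb => simp only [smul_add, map_add, ha, hb]; abel

theorem Covering.tensor_tmul (D : Covering X G) (D' : Covering X H) (g : G) (h : H) :
    (D.tensor D').toFun (g ⊗ₜ h) = D.toFun g ⊗ₜ[R] h + g ⊗ₜ[R] D'.toFun h := rfl

end Covering

/-! ### Extending operators from generators to exterior and symmetric algebras

A derivation `D` of an `R`-algebra `T` covering `X` is the same as the ring homomorphism
`t ↦ t + ε D t` into `T[ε]`, which is `R`-linear if `R` acts on `T[ε]` through
`r ↦ r + ε X(r)`.  The universal properties of the exterior and symmetric algebra then produce `D`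
from its values on generators. -/

section Extend

variable {R : Type*} [CommRing R] [Algebra ℝ R]

/-- The algebra `T[ε]`, with `R` acting through `r ↦ r + ε X(r)`. -/
def Twist (_X : Derivation ℝ R R) (T : Type*) : Type _ := TrivSqZeroExt T T

section

variable (X : Derivation ℝ R R) (T : Type*)

instance [Ring T] : Ring (Twist X T) := inferInstanceAs (Ring (TrivSqZeroExt T T))

instance [CommRing T] : CommRing (Twist X T) := inferInstanceAs (CommRing (TrivSqZeroExt T T))

/-- The element `a + ε b`. -/
def Twist.mk {T : Type*} (a b : T) : Twist X T := (a, b)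

variable {X T}

def Twist.fst (x : Twist X T) : T := x.1

def Twist.snd (x : Twist X T) : T := x.2

theorem Twist.ext {x y : Twist X T} (h1 : x.fst = y.fst) (h2 : x.snd = y.snd) : x = y :=
  Prod.ext h1 h2

@[simp] theorem Twist.fst_mk (a b : T) : (Twist.mk X a b).fst = a := rfl
@[simp] theorem Twist.snd_mk (a b : T) : (Twist.mk X a b).snd = b := rfl

variable [Ring T]

@[simp] theorem Twist.fst_add (x y : Twist X T) : (x + y).fst = x.fst + y.fst := rfl
@[simp] theorem Twist.snd_add (x y : Twist X T) : (x + y).snd = x.snd + y.snd := rfl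
@[simp] theorem Twist.fst_mul (x y : Twist X T) : (x * y).fst = x.fst * y.fst := rfl
@[simp] theorem Twist.snd_mul (x y : Twist X T) :
    (x * y).snd = x.fst * y.snd + x.snd * y.fst := by
  change x.fst • y.snd + MulOpposite.op y.fst • x.snd = _
  simp
@[simp] theorem Twist.fst_zero : (0 : Twist X T).fst = 0 := rfl
@[simp] theorem Twist.snd_zero : (0 : Twist X T).snd = 0 := rfl
@[simp] theorem Twist.fst_one : (1 : Twist X T).fst = 1 := rfl
@[simp] theorem Twist.snd_one : (1 : Twist X T).snd = 0 := rfl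

variable [Algebra R T]

/-- The ring homomorphism `r ↦ r + ε X(r)`. -/
def Twist.base (X : Derivation ℝ R R) (T : Type*) [Ring T] [Algebra R T] : R →+* Twist X T where
  toFun r := Twist.mk X (algebraMap R T r) (algebraMap R T (X r))
  map_one' := Twist.ext (by simp) (by simp)
  map_zero' := Twist.ext (by simp) (by simp)
  map_add' r s := Twist.ext (by simp) (by simp)
  map_mul' r s := Twist.ext (by simp) (by
    simp only [Twist.snd_mk, Twist.snd_mul, Twist.fst_mk, Derivation.leibniz, smul_eq_mul,
      map_add, ← map_mul]
    rw [mul_comm s])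

instance : Algebra R (Twist X T) :=
  (Twist.base X T).toAlgebra' (by
    intro r x
    refine Twist.ext ?_ ?_
    · exact Algebra.commutes r x.fst
    · simp only [Twist.snd_mul, Twist.base, RingHom.coe_mk, MonoidHom.coe_mk, OneHom.coe_mk,
        Twist.fst_mk, Twist.snd_mk]
      rw [Algebra.commutes, Algebra.commutes (X r), add_comm])

theorem Twist.fst_smul (r : R) (x : Twist X T) : (r • x).fst = r • x.fst := by
  rw [Algebra.smul_def, Algebra.smul_def]; rfl

theorem Twist.snd_smul (r : R) (x : Twist X T) : (r • x).snd = X r • x.fst + r • x.snd := by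
  rw [Algebra.smul_def, Algebra.smul_def, Algebra.smul_def, Twist.snd_mul, add_comm]; rfl

theorem Twist.fst_algebraMap (r : R) : (algebraMap R (Twist X T) r).fst = algebraMap R T r := rfl

theorem Twist.snd_algebraMap (r : R) :
    (algebraMap R (Twist X T) r).snd = algebraMap R T (X r) := rfl

end

variable {X : Derivation ℝ R R} {G : Type*} [AddCommGroup G] [Module R G]

/-- The homomorphism `t ↦ t + ε D t` on the exterior algebra. -/
def extHom (D : Covering X G) : ExteriorAlgebra R G →ₐ[R] Twist X (ExteriorAlgebra R G) :=
  ExteriorAlgebra.lift R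
    ⟨{ toFun := fun g => Twist.mk X (ExteriorAlgebra.ι R g) (ExteriorAlgebra.ι R (D.toFun g))
       map_add' := fun a b => Twist.ext (by simp) (by simp)
       map_smul' := fun r a => Twist.ext (by simp [Twist.fst_smul])
        (by simp [Twist.snd_smul, D.leibniz]) },
     fun g => Twist.ext (by simp) (by simp [ExteriorAlgebra.ι_add_mul_swap])⟩

theorem extHom_ι (D : Covering X G) (g : G) : extHom D (ExteriorAlgebra.ι R g) =
    Twist.mk X (ExteriorAlgebra.ι R g) (ExteriorAlgebra.ι R (D.toFun g)) := by
  simp [extHom]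

theorem extHom_fst (D : Covering X G) (x : ExteriorAlgebra R G) : (extHom D x).fst = x := by
  induction x using ExteriorAlgebra.induction with
  | algebraMap r => rw [AlgHom.commutes]; rfl
  | ι g => rw [extHom_ι]; rfl
  | mul a b ha hb => rw [map_mul, Twist.fst_mul, ha, hb]
  | add a b ha hb => rw [map_add, Twist.fst_add, ha, hb]

/-- The derivation of the exterior algebra that covers `X` and extends `D`. -/
def Covering.ext (D : Covering X G) : Covering X (ExteriorAlgebra R G) where
  toFun :=
    { toFun := fun x => (extHom D x).snd
      map_zero' := by simp
      map_add' := by simp }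
  leibniz := by
    intro r x
    simp [Twist.snd_smul, extHom_fst]

theorem Covering.ext_algebraMap (D : Covering X G) (r : R) :
    D.ext.toFun (algebraMap R _ r) = algebraMap R _ (X r) := by
  change (extHom D (algebraMap R _ r)).snd = _
  rw [AlgHom.commutes]; rfl

theorem Covering.ext_ι (D : Covering X G) (g : G) :
    D.ext.toFun (ExteriorAlgebra.ι R g) = ExteriorAlgebra.ι R (D.toFun g) := by
  change (extHom D _).snd = _
  rw [extHom_ι]; rfl

theorem Covering.ext_mul (D : Covering X G) (x y : ExteriorAlgebra R G) :
    D.ext.toFun (x * y) = x * D.ext.toFun y + D.ext.toFun x * y := by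
  change (extHom D _).snd = x * (extHom D y).snd + (extHom D x).snd * y
  rw [map_mul, Twist.snd_mul, extHom_fst, extHom_fst]

/-- The homomorphism `t ↦ t + ε D t` on the symmetric algebra. -/
def symHom (X : Derivation ℝ R R) (d : G →+ SymmetricAlgebra R G)
    (hd : ∀ (r : R) g, d (r • g) = X r • SymmetricAlgebra.ι R G g + r • d g) :
    SymmetricAlgebra R G →ₐ[R] Twist X (SymmetricAlgebra R G) :=
  SymmetricAlgebra.lift
    { toFun := fun g => Twist.mk X (SymmetricAlgebra.ι R G g) (d g)
      map_add' := fun a b => Twist.ext (by simp) (by simp)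
      map_smul' := fun r a => Twist.ext (by simp [Twist.fst_smul])
        (by simp [Twist.snd_smul, hd]) }

/-- The derivation of the symmetric algebra that covers `X` and is `d` on generators. -/
def symExtend (X : Derivation ℝ R R) (d : G →+ SymmetricAlgebra R G)
    (hd : ∀ (r : R) g, d (r • g) = X r • SymmetricAlgebra.ι R G g + r • d g) :
    SymmetricAlgebra R G →+ SymmetricAlgebra R G where
  toFun := fun x => (symHom X d hd x).snd
  map_zero' := by simp
  map_add' := by simp

section

variable (d : G →+ SymmetricAlgebra R G)
    (hd : ∀ (r : R) g, d (r • g) = X r • SymmetricAlgebra.ι R G g + r • d g)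

theorem symHom_ι (g : G) : symHom X d hd (SymmetricAlgebra.ι R G g) =
    Twist.mk X (SymmetricAlgebra.ι R G g) (d g) := by
  simp [symHom]

theorem symHom_fst (x : SymmetricAlgebra R G) : (symHom X d hd x).fst = x := by
  induction x using SymmetricAlgebra.induction with
  | algebraMap r => rw [AlgHom.commutes]; rfl
  | ι g => rw [symHom_ι]; rfl
  | mul a b ha hb => rw [map_mul, Twist.fst_mul, ha, hb]
  | add a b ha hb => rw [map_add, Twist.fst_add, ha, hb]

theorem symExtend_smul (r : R) (x : SymmetricAlgebra R G) :
    symExtend X d hd (r • x) = X r • x + r • symExtend X d hd x := by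
  change (symHom X d hd _).snd = X r • x + r • (symHom X d hd x).snd
  rw [map_smul, Twist.snd_smul, symHom_fst]

theorem symExtend_algebraMap (r : R) :
    symExtend X d hd (algebraMap R _ r) = algebraMap R _ (X r) := by
  change (symHom X d hd (algebraMap R _ r)).snd = _
  rw [AlgHom.commutes]; rfl

theorem symExtend_ι (g : G) : symExtend X d hd (SymmetricAlgebra.ι R G g) = d g := by
  change (symHom X d hd _).snd = _
  rw [symHom_ι]; rfl

theorem symExtend_mul (x y : SymmetricAlgebra R G) :
    symExtend X d hd (x * y) = x * symExtend X d hd y + symExtend X d hd x * y := by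
  change (symHom X d hd _).snd = x * (symHom X d hd y).snd + (symHom X d hd x).snd * y
  rw [map_mul, Twist.snd_mul, symHom_fst, symHom_fst]

end

/-- The derivation of the symmetric algebra that covers `X` and extends `D`. -/
def Covering.sym (D : Covering X G) : Covering X (SymmetricAlgebra R G) where
  toFun := symExtend X ((SymmetricAlgebra.ι R G).toAddMonoidHom.comp D.toFun)
    (by intro r g; simp [D.leibniz])
  leibniz := symExtend_smul _ _

theorem Covering.sym_algebraMap (D : Covering X G) (r : R) :
    D.sym.toFun (algebraMap R _ r) = algebraMap R _ (X r) := symExtend_algebraMap _ _ r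

theorem Covering.sym_ι (D : Covering X G) (g : G) :
    D.sym.toFun (SymmetricAlgebra.ι R G g) = SymmetricAlgebra.ι R G (D.toFun g) :=
  symExtend_ι _ _ g

theorem Covering.sym_mul (D : Covering X G) (x y : SymmetricAlgebra R G) :
    D.sym.toFun (x * y) = x * D.sym.toFun y + D.sym.toFun x * y := symExtend_mul _ _ x y

/-- The `R`-linear derivation of the symmetric algebra given by `φ ∈ G^*` on generators. -/
def symContract (φ : Module.Dual R G) : SymmetricAlgebra R G →ₗ[R] SymmetricAlgebra R G where
  toFun := symExtend 0 ((Algebra.linearMap R (SymmetricAlgebra R G)).toAddMonoidHom.comp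
      φ.toAddMonoidHom) (by intro r g; simp [Algebra.smul_def])
  map_add' := map_add _
  map_smul' := by intro r x; simp [symExtend_smul]

end Extend

section Unique

variable {R : Type*} [CommRing R] {G : Type*} [AddCommGroup G] [Module R G]

/-- Additive operators that satisfy the Leibniz rule and agree on generators agree. -/
theorem ext_unique (D D' : ExteriorAlgebra R G →+ ExteriorAlgebra R G)
    (hD : ∀ x y, D (x * y) = x * D y + D x * y) (hD' : ∀ x y, D' (x * y) = x * D' y + D' x * y)
    (h0 : ∀ r, D (algebraMap R _ r) = D' (algebraMap R _ r))
    (h1 : ∀ g, D (ExteriorAlgebra.ι R g) = D' (ExteriorAlgebra.ι R g)) : D = D' := by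
  ext x
  induction x using ExteriorAlgebra.induction with
  | algebraMap r => exact h0 r
  | ι g => exact h1 g
  | mul a b ha hb => rw [hD, hD', ha, hb]
  | add a b ha hb => rw [map_add, map_add, ha, hb]

theorem sym_unique (D D' : SymmetricAlgebra R G →+ SymmetricAlgebra R G)
    (hD : ∀ x y, D (x * y) = x * D y + D x * y) (hD' : ∀ x y, D' (x * y) = x * D' y + D' x * y)
    (h0 : ∀ r, D (algebraMap R _ r) = D' (algebraMap R _ r))
    (h1 : ∀ g, D (SymmetricAlgebra.ι R G g) = D' (SymmetricAlgebra.ι R G g)) : D = D' := by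
  ext x
  induction x using SymmetricAlgebra.induction with
  | algebraMap r => exact h0 r
  | ι g => exact h1 g
  | mul a b ha hb => rw [hD, hD', ha, hb]
  | add a b ha hb => rw [map_add, map_add, ha, hb]

end Unique

/-! ### Connections induced on duals, tensor products, exterior and symmetric algebras -/

section Induced

variable {R : Type*} [CommRing R] [Algebra ℝ R] {G : Type*} [AddCommGroup G] [Module R G]
  {H : Type*} [AddCommGroup H] [Module R H]

/-- The dual connection. -/
def Connection.dual (D : Connection R G) : Connection R (Module.Dual R G) where
  cov X := (D.cov X).dual
  add_left X Y τ := by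
    ext g
    change (X + Y) (τ g) - τ ((D.cov (X + Y)).toFun g) =
      (X (τ g) - τ ((D.cov X).toFun g)) + (Y (τ g) - τ ((D.cov Y).toFun g))
    rw [D.add_left, map_add, Derivation.add_apply]; ring
  smul_left r X τ := by
    ext g
    change (r • X) (τ g) - τ ((D.cov (r • X)).toFun g) =
      r • (X (τ g) - τ ((D.cov X).toFun g))
    rw [D.smul_left, map_smul, Derivation.smul_apply, smul_sub]

/-- The connection on a tensor product. -/
def Connection.tensor (D : Connection R G) (D' : Connection R H) : Connection R (G ⊗[R] H) where
  cov X := (D.cov X).tensor (D'.cov X)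
  add_left X Y x := by
    induction x using TensorProduct.induction_on with
    | zero => simp
    | tmul g h =>
      simp only [Covering.tensor_tmul, D.add_left, D'.add_left, TensorProduct.add_tmul,
        TensorProduct.tmul_add]
      abel
    | add a b ha hb => simp only [map_add, ha, hb]; abel
  smul_left r X x := by
    induction x using TensorProduct.induction_on with
    | zero => simp
    | tmul g h =>
      simp only [Covering.tensor_tmul, D.smul_left, D'.smul_left, smul_add,
        TensorProduct.smul_tmul', TensorProduct.tmul_smul]
    | add a b ha hb => simp only [map_add, ha, hb, smul_add]

/-- The connection on the exterior algebra, acting by derivations. -/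
def Connection.ext (D : Connection R G) : Connection R (ExteriorAlgebra R G) where
  cov X := (D.cov X).ext
  add_left X Y x := by
    refine DFunLike.congr_fun (ext_unique (D.cov (X + Y)).ext.toFun
      ((D.cov X).ext.toFun + (D.cov Y).ext.toFun) ?_ ?_ ?_ ?_) x
    · exact Covering.ext_mul _
    · intro x y; simp only [AddMonoidHom.add_apply, Covering.ext_mul, mul_add, add_mul]; abel
    · intro r; simp [Covering.ext_algebraMap]
    · intro g; simp [Covering.ext_ι, D.add_left]
  smul_left r X x := by
    refine DFunLike.congr_fun (ext_unique (D.cov (r • X)).ext.toFun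
      (r • (D.cov X).ext.toFun) ?_ ?_ ?_ ?_) x
    · exact Covering.ext_mul _
    · intro x y
      simp only [AddMonoidHom.smul_apply, Covering.ext_mul, smul_add, mul_smul_comm,
        smul_mul_assoc]
    · intro s; simp [Covering.ext_algebraMap, Algebra.smul_def]
    · intro g; simp [Covering.ext_ι, D.smul_left]

/-- The connection on the symmetric algebra, acting by derivations. -/
def Connection.sym (D : Connection R G) : Connection R (SymmetricAlgebra R G) where
  cov X := (D.cov X).sym
  add_left X Y x := by
    refine DFunLike.congr_fun (sym_unique (D.cov (X + Y)).sym.toFun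
      ((D.cov X).sym.toFun + (D.cov Y).sym.toFun) ?_ ?_ ?_ ?_) x
    · exact Covering.sym_mul _
    · intro x y
      simp only [AddMonoidHom.add_apply, Covering.sym_mul, mul_add, add_mul]; abel
    · intro r; simp [Covering.sym_algebraMap]
    · intro g; simp [Covering.sym_ι, D.add_left]
  smul_left r X x := by
    refine DFunLike.congr_fun (sym_unique (D.cov (r • X)).sym.toFun
      (r • (D.cov X).sym.toFun) ?_ ?_ ?_ ?_) x
    · exact Covering.sym_mul _
    · intro x y
      simp only [AddMonoidHom.smul_apply, Covering.sym_mul, smul_add, mul_smul_comm,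
        smul_mul_assoc]
    · intro s; simp [Covering.sym_algebraMap, Algebra.smul_def]
    · intro g; simp [Covering.sym_ι, D.smul_left]

/-- The contraction of the symmetric algebra, linear in the contracted element. -/
def symContractₗ : Module.Dual R G →ₗ[R] SymmetricAlgebra R G →ₗ[R] SymmetricAlgebra R G where
  toFun := symContract
  map_add' φ ψ := by
    refine LinearMap.toAddMonoidHom_injective (sym_unique _ _ ?_ ?_ ?_ ?_)
    · exact symExtend_mul _ _
    · intro x y
      change symExtend _ _ _ _ + symExtend _ _ _ _ = x * (symExtend _ _ _ _ + symExtend _ _ _ _)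
        + (symExtend _ _ _ _ + symExtend _ _ _ _) * y
      simp only [symExtend_mul, mul_add, add_mul]; abel
    · intro r; simp [symContract, symExtend_algebraMap]
    · intro g; simp [symContract, symExtend_ι]
  map_smul' r φ := by
    refine LinearMap.toAddMonoidHom_injective (sym_unique _ _ ?_ ?_ ?_ ?_)
    · exact symExtend_mul _ _
    · intro x y
      change r • symExtend _ _ _ _ = x * (r • symExtend _ _ _ _) + (r • symExtend _ _ _ _) * y
      simp only [symExtend_mul, smul_add, mul_smul_comm, smul_mul_assoc]
    · intro s; simp [symContract, symExtend_algebraMap]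
    · intro g; simp [symContract, symExtend_ι, Algebra.smul_def]

end Induced

/-! ### Graded algebras, vector fields, homological vector fields -/

section Graded

variable {R : Type*} [CommRing R] {A : Type*} [Ring A] [Algebra R A]

section VectorFields

variable [Algebra ℝ R] [Algebra ℝ A] [IsScalarTower ℝ R A]

/-- Vector fields of degree `j`: graded derivations of degree `j` of the graded algebra of
functions. -/
def IsVectorField (𝒜 : ℤ → Submodule R A) (j : ℤ) (d : A →ₗ[ℝ] A) : Prop :=
  (∀ i, ∀ ξ ∈ 𝒜 i, d ξ ∈ 𝒜 (i + j)) ∧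
    ∀ i, ∀ ξ ∈ 𝒜 i, ∀ ζ, d (ξ * ζ) = d ξ * ζ + (j * i).negOnePow • (ξ * d ζ)

/-- The left `A`-module of vector fields, spanned by the homogeneous ones; `A` acts by
`(ξ 𝒳)(ζ) = ξ 𝒳(ζ)`. -/
def vectorFields (𝒜 : ℤ → Submodule R A) : Submodule A (A →ₗ[ℝ] A) :=
  Submodule.span A {d | ∃ j, IsVectorField 𝒜 j d}

/-- A homological vector field. -/
structure HomologicalVectorField (𝒜 : ℤ → Submodule R A) where
  toFun : A →ₗ[ℝ] A
  isVectorField : IsVectorField 𝒜 1 toFun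
  sq_zero : ∀ ξ, toFun (toFun ξ) = 0

end VectorFields

/-- The elements of degree `p` of `A ⊗ V`, where `A` is graded and `V = ⨁ E_j[j]`, so that `E_j`
sits in degree `-j`. -/
def totalDegree (𝒜 : ℤ → Submodule R A) {V : Type*} [AddCommGroup V] [Module R V]
    (E : ℤ → Submodule R V) (p : ℤ) : Submodule R (A ⊗[R] V) :=
  Submodule.span R {w | ∃ i j, i - j = p ∧ ∃ ξ ∈ 𝒜 i, ∃ e ∈ E j, w = ξ ⊗ₜ[R] e}

section Rep

variable [Algebra ℝ R] [Algebra ℝ A] [IsScalarTower ℝ R A]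
  {𝒜 : ℤ → Submodule R A} (Q : HomologicalVectorField 𝒜)

/-- A (left) representation up to homotopy of `(𝒜, Q)` on `V = Γ(⨁ E_j[j])`: a left differential
graded module of the form `A ⊗ V`. -/
structure RepUpToHomotopy {V : Type*} [AddCommGroup V] [Module R V]
    (E : ℤ → Submodule R V) where
  D : A ⊗[R] V →ₗ[ℝ] A ⊗[R] V
  degree : ∀ p, ∀ w ∈ totalDegree 𝒜 E p, D w ∈ totalDegree 𝒜 E (p + 1)
  leibniz : ∀ i, ∀ ξ ∈ 𝒜 i, ∀ w, D (ξ • w) = Q.toFun ξ • w + i.negOnePow • (ξ • D w)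
  sq_zero : ∀ w, D (D w) = 0

variable {Q}

/-- An isomorphism (of degree `0`, over the identity of `(𝒜, Q)`) of representations up to
homotopy. -/
structure RepIso {V : Type*} [AddCommGroup V] [Module R V] {E : ℤ → Submodule R V}
    {V' : Type*} [AddCommGroup V'] [Module R V'] {E' : ℤ → Submodule R V'}
    (ρ : RepUpToHomotopy Q E) (ρ' : RepUpToHomotopy Q E') where
  toEquiv : (A ⊗[R] V) ≃ₗ[A] (A ⊗[R] V')
  degree : ∀ p w, toEquiv w ∈ totalDegree 𝒜 E' p ↔ w ∈ totalDegree 𝒜 E p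
  comm : ∀ w, toEquiv (ρ.D w) = ρ'.D (toEquiv w)

end Rep

end Graded

section ExtendLinear

variable {R : Type*} [CommRing R]

/-- The `A`-linear extension `A ⊗ V → W` of an `R`-linear map `V → W`. -/
def extendLinear (A : Type*) [Ring A] [Algebra R A] {V W : Type*} [AddCommGroup V] [Module R V]
    [AddCommGroup W] [Module R W] [Module A W] [IsScalarTower R A W] (φ : V →ₗ[R] W) :
    A ⊗[R] V →ₗ[A] W :=
  TensorProduct.AlgebraTensorModule.lift
    { toFun := fun a =>
        { toFun := fun v => a • φ v
          map_add' := by intro x y; rw [map_add, smul_add]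
          map_smul' := by
            intro r x
            rw [map_smul, RingHom.id_apply, ← algebraMap_smul A r (φ x), ← algebraMap_smul A r,
              smul_smul, smul_smul, Algebra.commutes] }
      map_add' := by intro a b; ext v; simp [add_smul]
      map_smul' := by intro a b; ext v; simp [mul_smul] }

theorem extendLinear_tmul (A : Type*) [Ring A] [Algebra R A] {V W : Type*} [AddCommGroup V]
    [Module R V] [AddCommGroup W] [Module R W] [Module A W] [IsScalarTower R A W]
    (φ : V →ₗ[R] W) (a : A) (v : V) : extendLinear A φ (a ⊗ₜ v) = a • φ v := rfl

end ExtendLinear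

/-! ### Splittings

Here `R = C^∞(M)`, `G₁ = Γ(Q)` and `G₂ = Γ(B^*)`.  Hence `Module.Dual R G₁ = Γ(Q^*) = Ω¹(Q)` and
`Module.Dual R G₂ = Γ(B)`. -/

section Splitting

variable (R : Type*) [CommRing R] (G₁ : Type*) [AddCommGroup G₁] [Module R G₁]
  (G₂ : Type*) [AddCommGroup G₂] [Module R G₂]

/-- The algebra `Γ(∧ Q^* ⊗ S B)` of functions on the split manifold `Q[1] ⊕ B^*[2]`. -/
abbrev SplitFun : Type _ :=
  ExteriorAlgebra R (Module.Dual R G₁) ⊗[R] SymmetricAlgebra R (Module.Dual R G₂)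

/-- The functions of degree `k`: those of `Γ(∧^i Q^* ⊗ S^j B)` with `i + 2j = k`. -/
def splitDegree (k : ℤ) : Submodule R (SplitFun R G₁ G₂) :=
  Submodule.span R {w | ∃ i j : ℕ, (i : ℤ) + 2 * j = k ∧
    ∃ x ∈ ⋀[R]^i (Module.Dual R G₁),
    ∃ y ∈ LinearMap.range (SymmetricAlgebra.ι R (Module.Dual R G₂)) ^ j, w = x ⊗ₜ[R] y}

variable {R} {A : Type*} [Ring A] [Algebra R A]

/-- A splitting of the `[2]`-manifold with graded algebra of functions `𝒜`: an isomorphism with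
`Q[1] ⊕ B^*[2]` over the identity of `M`. -/
structure Splitting (𝒜 : ℤ → Submodule R A) where
  toEquiv : SplitFun R G₁ G₂ ≃ₐ[R] A
  degree : ∀ k x, toEquiv x ∈ 𝒜 k ↔ x ∈ splitDegree R G₁ G₂ k

/-- `Γ(TM ⊕ Q ⊕ B^*)`, the complex of the adjoint representation. -/
abbrev AdSpace (R : Type*) [CommRing R] [Algebra ℝ R] (G₁ : Type*) [AddCommGroup G₁] [Module R G₁]
    (G₂ : Type*) [AddCommGroup G₂] [Module R G₂] : Type _ :=
  Derivation ℝ R R × G₁ × G₂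

/-- The grading `TM[0] ⊕ Q[1] ⊕ B^*[2]`. -/
def adGrading (R : Type*) [CommRing R] [Algebra ℝ R] (G₁ : Type*) [AddCommGroup G₁] [Module R G₁]
    (G₂ : Type*) [AddCommGroup G₂] [Module R G₂] (j : ℤ) : Submodule R (AdSpace R G₁ G₂) where
  carrier := {v | (j ≠ 0 → v.1 = 0) ∧ (j ≠ 1 → v.2.1 = 0) ∧ (j ≠ 2 → v.2.2 = 0)}
  zero_mem' := by simp
  add_mem' := by
    rintro a b ⟨h1, h2, h3⟩ ⟨h1', h2', h3'⟩
    exact ⟨fun h => by simp [h1 h, h1' h], fun h => by simp [h2 h, h2' h],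
      fun h => by simp [h3 h, h3' h]⟩
  smul_mem' := by
    rintro r a ⟨h1, h2, h3⟩
    exact ⟨fun h => by simp [h1 h], fun h => by simp [h2 h], fun h => by simp [h3 h]⟩

variable {G₁ G₂}

/-- The function of degree `1` given by `τ ∈ Γ(Q^*)`. -/
def Splitting.fn₁ {𝒜 : ℤ → Submodule R A} (S : Splitting G₁ G₂ 𝒜) (τ : Module.Dual R G₁) : A :=
  S.toEquiv (ExteriorAlgebra.ι R τ ⊗ₜ[R] 1)

/-- The function of degree `2` given by `b ∈ Γ(B)`. -/
def Splitting.fn₂ {𝒜 : ℤ → Submodule R A} (S : Splitting G₁ G₂ 𝒜) (b : Module.Dual R G₂) : A :=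
  S.toEquiv (1 ⊗ₜ[R] SymmetricAlgebra.ι R (Module.Dual R G₂) b)

/-- The function given by a `Q`-form. -/
def Splitting.form {𝒜 : ℤ → Submodule R A} (S : Splitting G₁ G₂ 𝒜) :
    ExteriorAlgebra R (Module.Dual R G₁) →ₐ[R] A :=
  S.toEquiv.toAlgHom.comp Algebra.TensorProduct.includeLeft

/-- `i_q`, the contraction of `Q`-forms with `q ∈ Γ(Q)`: `(i_q θ)(q', …) = θ(q, q', …)`. -/
def contractForm (q : G₁) : ExteriorAlgebra R (Module.Dual R G₁) →ₗ[R]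
    ExteriorAlgebra R (Module.Dual R G₁) :=
  CliffordAlgebra.contractLeft (Module.Dual.eval R G₁ q)

/-- The vector field `q̂` of degree `-1` on `Q[1] ⊕ B^*[2]`. -/
def hat₁ (q : G₁) : SplitFun R G₁ G₂ →ₗ[R] SplitFun R G₁ G₂ :=
  (contractForm q).rTensor _

variable [Algebra ℝ R]

/-- The vector field `β̂` of degree `-2` on `Q[1] ⊕ B^*[2]`. -/
def hat₂ (β : G₂) : SplitFun R G₁ G₂ →ₗ[R] SplitFun R G₁ G₂ :=
  (symContractₗ (Module.Dual.eval R G₂ β)).lTensor _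

variable [Algebra ℝ A] [IsScalarTower ℝ R A]
  {𝒜 : ℤ → Submodule R A} (S : Splitting G₁ G₂ 𝒜)
  (D₁ : Connection R G₁) (D₂ : Connection R G₂)

/-- The connection on `Γ(∧ Q^* ⊗ S B)` induced by `TM`-connections on `Q` and `B^*`; thus
`∇_X` is the vector field of degree `0` on `Q[1] ⊕ B^*[2]` defined by the two connections. -/
def splitConnection : Connection R (SplitFun R G₁ G₂) :=
  D₁.dual.ext.tensor D₂.dual.sym

/-- The value of `μ_∇` on generators: `X ↦ ∇_X`, `q ↦ q̂`, `β ↦ β̂`. -/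
def adToVectorField : AdSpace R G₁ G₂ →ₗ[R] (A →ₗ[ℝ] A) where
  toFun v :=
    { toFun := fun a => S.toEquiv
        (((splitConnection D₁ D₂).cov v.1).toFun (S.toEquiv.symm a) +
          hat₁ v.2.1 (S.toEquiv.symm a) + hat₂ v.2.2 (S.toEquiv.symm a))
      map_add' := by intro a b; simp only [map_add]; abel
      map_smul' := by
        intro c a
        have h : ∀ a : A, c • a = algebraMap ℝ R c • a := fun a => (algebraMap_smul R c a).symm
        rw [RingHom.id_apply, h a, h (S.toEquiv _), ← map_smul S.toEquiv, map_smul S.toEquiv.symm,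
          Covering.leibniz, map_smul, map_smul, Derivation.map_algebraMap, zero_smul, zero_add,
          smul_add, smul_add] }
  map_add' u v := by
    ext a
    simp only [LinearMap.coe_mk, AddHom.coe_mk, LinearMap.add_apply, Prod.fst_add, Prod.snd_add,
      Connection.add_left, hat₁, hat₂, contractForm, map_add, LinearMap.rTensor_add,
      LinearMap.lTensor_add]
    abel
  map_smul' r v := by
    ext a
    simp only [LinearMap.coe_mk, AddHom.coe_mk, LinearMap.smul_apply, Prod.smul_fst, Prod.smul_snd,
      Connection.smul_left, hat₁, hat₂, contractForm, map_smul, LinearMap.rTensor_smul,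
      LinearMap.lTensor_smul, RingHom.id_apply, ← smul_add]

/-- The map `μ_∇` from `A ⊗ Γ(TM ⊕ Q ⊕ B^*)` to the vector fields. -/
def adMap : A ⊗[R] AdSpace R G₁ G₂ →ₗ[A] (A →ₗ[ℝ] A) :=
  extendLinear A (adToVectorField S D₁ D₂)

/-- `ρ` is the adjoint representation: its differential is `μ_∇⁻¹ ∘ [Q, ·] ∘ μ_∇`, where
`[Q, 𝒳] = Q 𝒳 - (-1)^{|𝒳|} 𝒳 Q` is the graded commutator. -/
def IsAdjointRep {Q : HomologicalVectorField 𝒜} (ρ : RepUpToHomotopy Q (adGrading R G₁ G₂)) :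
    Prop :=
  ∀ p, ∀ w ∈ totalDegree 𝒜 (adGrading R G₁ G₂) p,
    adMap S D₁ D₂ (ρ.D w) =
      Q.toFun ∘ₗ adMap S D₁ D₂ w - p.negOnePow • (adMap S D₁ D₂ w ∘ₗ Q.toFun)

/-! ### Change of splitting -/

/-- `Ω²(Q, B^*) = Ω²(Q) ⊗ Γ(B^*)`. -/
abbrev TwoForm (R : Type*) [CommRing R] (G₁ : Type*) [AddCommGroup G₁] [Module R G₁]
    (G₂ : Type*) [AddCommGroup G₂] [Module R G₂] : Type _ :=
  ⋀[R]^2 (Module.Dual R G₁) ⊗[R] G₂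

/-- A `B^*`-valued `2`-form as an element of `Ω(Q) ⊗ Γ(B^*)`. -/
def TwoForm.incl (σ : TwoForm R G₁ G₂) : ExteriorAlgebra R (Module.Dual R G₁) ⊗[R] G₂ :=
  (Submodule.subtype _).rTensor G₂ σ

/-- `σ^* b = ⟨σ, b⟩ ∈ Ω²(Q)`. -/
def TwoForm.pullback (σ : TwoForm R G₁ G₂) (b : Module.Dual R G₂) :
    ExteriorAlgebra R (Module.Dual R G₁) :=
  TensorProduct.rid R _ (b.lTensor _ σ.incl)

/-- `σ` is the change from the splitting `S₁` to the splitting `S₂`: the induced isomorphism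
`S₂⁻¹ ∘ S₁` of split algebras sends `τ` to `τ` and `b` to `b + σ^* b`. -/
def IsChangeOfSplitting (S₁ S₂ : Splitting G₁ G₂ 𝒜) (σ : TwoForm R G₁ G₂) : Prop :=
  (∀ τ, S₁.fn₁ τ = S₂.fn₁ τ) ∧ ∀ b, S₁.fn₂ b = S₂.fn₂ b + S₂.form (σ.pullback b)

/-- A `B^*`-valued `Q`-form as an element of `A ⊗ Γ(TM ⊕ Q ⊕ B^*)`. -/
def formToAd : ExteriorAlgebra R (Module.Dual R G₁) ⊗[R] G₂ →ₗ[R] A ⊗[R] AdSpace R G₁ G₂ :=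
  TensorProduct.map S.form.toLinearMap
    (LinearMap.inr R (Derivation ℝ R R) (G₁ × G₂) ∘ₗ LinearMap.inr R G₁ G₂)

/-- The map `id ⊕ σ ⊕ ∇_· σ` on generators: `β ↦ β`, `q ↦ q + i_q σ = q + σ(q, ·)` and
`X ↦ X + ∇_X σ`. -/
def changeOnGenerators (σ : TwoForm R G₁ G₂) :
    AdSpace R G₁ G₂ →ₗ[R] A ⊗[R] AdSpace R G₁ G₂ where
  toFun v := 1 ⊗ₜ[R] v + formToAd S ((contractForm v.2.1).rTensor G₂ σ.incl) +
    formToAd S (((D₁.dual.ext.tensor D₂).cov v.1).toFun σ.incl)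
  map_add' u v := by
    simp only [TensorProduct.tmul_add, Prod.fst_add, Prod.snd_add, Connection.add_left,
      contractForm, map_add, LinearMap.rTensor_add, LinearMap.add_apply]
    abel
  map_smul' r v := by
    simp only [TensorProduct.tmul_smul, Prod.smul_fst, Prod.smul_snd, Connection.smul_left,
      contractForm, map_smul, LinearMap.rTensor_smul, LinearMap.smul_apply, RingHom.id_apply,
      ← smul_add]

/-- The `A`-linear map `id ⊕ σ ⊕ ∇_· σ`. -/
def changeMap (σ : TwoForm R G₁ G₂) : A ⊗[R] AdSpace R G₁ G₂ →ₗ[A] A ⊗[R] AdSpace R G₁ G₂ :=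
  extendLinear A (changeOnGenerators S D₁ D₂ σ)

end Splitting

/-! ### Smooth sections -/

section Sections

variable {E : Type*} [NormedAddCommGroup E] [NormedSpace ℝ E] {H : Type*} [TopologicalSpace H]
  {I : ModelWithCorners ℝ E H} {M : Type*} [TopologicalSpace M] [ChartedSpace H M]
  {F : Type*} [NormedAddCommGroup F] [NormedSpace ℝ F]
  {V : M → Type*} [TopologicalSpace (TotalSpace F V)] [∀ x, TopologicalSpace (V x)]
  [FiberBundle F V] [∀ x, AddCommGroup (V x)] [∀ x, Module ℝ (V x)] [VectorBundle ℝ F V]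

/-- Pointwise multiplication of a section by a function. -/
instance sectionSMul : SMul C^∞⟮I, M; ℝ⟯ Cₛ^∞⟮I; F, V⟯ where
  smul f s := ⟨fun x => f x • s x, f.contMDiff.smul_section s.contMDiff⟩

theorem section_smul_apply (f : C^∞⟮I, M; ℝ⟯) (s : Cₛ^∞⟮I; F, V⟯) (x : M) :
    (f • s) x = f x • s x := rfl

/-- `Γ(V)` is a `C^∞(M)`-module. -/
instance sectionModule : Module C^∞⟮I, M; ℝ⟯ Cₛ^∞⟮I; F, V⟯ where
  one_smul s := ContMDiffSection.ext fun x => one_smul ℝ (s x)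
  mul_smul f g s := ContMDiffSection.ext fun x => mul_smul (f x) (g x) (s x)
  smul_zero f := ContMDiffSection.ext fun x => smul_zero (f x)
  smul_add f s t := ContMDiffSection.ext fun x => smul_add (f x) (s x) (t x)
  add_smul f g s := ContMDiffSection.ext fun x => add_smul (f x) (g x) (s x)
  zero_smul s := ContMDiffSection.ext fun x => zero_smul ℝ (s x)

end Sections

end LieTwo

end

/-! A derivation of the function algebra is determined by its values on `C^∞(M)`, `Γ(Q^*)` and
`Γ(B)`, and on these generators `μ_∇` is triangular: on `C^∞(M)` only the `TM` component acts, on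
`Γ(Q^*)` the `B^*` component vanishes, and the hatted fields act on their own generators by plain
evaluation. So injectivity (`eq_zero_of_adMap_generators`) and surjectivity (`exists_adMap_eq`)
follow by peeling off the `TM`, `Q` and `B^*` components in this order. For `Q` and `B^*` this uses
dual bases of the section modules. For `TM`, which enters as the module of derivations of `C^∞(M)`,
finiteness is used on the other tensor factor: the algebra of functions is projective over `C^∞(M)`,
and each of its degrees is finitely generated projective.

Once `μ_∇` identifies `A ⊗ Γ(TM ⊕ Q ⊕ B^*)` with the vector fields, compatibly with degrees, the
rest is transport of structure. The operator `[Q, ·]` preserves vector fields, obeys the Leibniz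
rule and squares to zero because `Q` is odd with `Q² = 0`; pulling it back gives the only adjoint
representation. For two sets of choices, one `μ_∇` followed by the inverse of the other is an
isomorphism (`exists_repIso`). For a change of splitting this composite is computed on generators:
the two images of `(X, q, β)` differ only on `Γ(B)`, by the contraction with `i_q σ + ∇_X σ`
(`IsChangeOfSplitting.adMap_changeOnGenerators`).

The analytic input is that sections of a vector bundle over a possibly non-compact `M` form a
finitely generated projective module (`finite_sections`, `projective_sections`). Over a compact set
finitely many sections span the fibres, and a Hausdorff dimension argument (`exists_spansAt_pred`)
lowers their number to a bound independent of the compact set. Layers of a compact exhaustion with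
the same parity are disjoint, so two glued families span everywhere (`exists_spansAt`); a partition
of unity then supplies coefficient functionals (`exists_coefficients`). -/

noncomputable section

set_option linter.unusedSectionVars false

namespace LieTwo

/-! ### Generators of the function algebra and graded commutativity. -/

section GradedSplitting

variable {R : Type*} [CommRing R] {G₁ : Type*} [AddCommGroup G₁] [Module R G₁]
  {G₂ : Type*} [AddCommGroup G₂] [Module R G₂] {A : Type*} [Ring A] [Algebra R A]
  {𝒜 : ℤ → Submodule R A} (S : Splitting G₁ G₂ 𝒜)

/-- Homogeneous functions are sums of products of the generating functions. -/
theorem Splitting.homogeneous_induction {P : ℤ → A → Prop}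
    (zero : ∀ k, P k 0) (add : ∀ k a b, P k a → P k b → P k (a + b))
    (base : ∀ r, P 0 (algebraMap R A r)) (gen₁ : ∀ τ, P 1 (S.fn₁ τ)) (gen₂ : ∀ b, P 2 (S.fn₂ b))
    (mul : ∀ i j a b, P i a → P j b → P (i + j) (a * b)) {k : ℤ} {a : A} (ha : a ∈ 𝒜 k) :
    P k a := by
  have h₁ : ∀ (i : ℕ) (x : ExteriorAlgebra R (Module.Dual R G₁)), x ∈ ⋀[R]^i (Module.Dual R G₁) →
      P i (S.toEquiv (x ⊗ₜ[R] 1)) := by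
    intro i x hx
    induction hx using Submodule.pow_induction_on_left' with
    | algebraMap r =>
      have : (algebraMap R (ExteriorAlgebra R (Module.Dual R G₁)) r) ⊗ₜ[R]
          (1 : SymmetricAlgebra R (Module.Dual R G₂)) = algebraMap R _ r := rfl
      rw [this, AlgEquiv.commutes]
      exact base r
    | add x y i hx hy ihx ihy => rw [TensorProduct.add_tmul, map_add]; exact add _ _ _ ihx ihy
    | mem_mul m hm i x hx ih =>
      obtain ⟨τ, rfl⟩ := hm
      have := mul _ _ _ _ (gen₁ τ) ih
      rw [Splitting.fn₁, ← map_mul, Algebra.TensorProduct.tmul_mul_tmul, one_mul] at this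
      convert this using 1
      push_cast; ring
  have h₂ : ∀ (j : ℕ) (y : SymmetricAlgebra R (Module.Dual R G₂)),
      y ∈ LinearMap.range (SymmetricAlgebra.ι R (Module.Dual R G₂)) ^ j →
      P (2 * j) (S.toEquiv (1 ⊗ₜ[R] y)) := by
    intro i x hx
    induction hx using Submodule.pow_induction_on_left' with
    | algebraMap r =>
      have : (1 : ExteriorAlgebra R (Module.Dual R G₁)) ⊗ₜ[R]
          (algebraMap R (SymmetricAlgebra R (Module.Dual R G₂)) r) = algebraMap R _ r :=
        (Algebra.TensorProduct.algebraMap_apply' r).symm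
      rw [this, AlgEquiv.commutes]
      exact base r
    | add x y i hx hy ihx ihy => rw [TensorProduct.tmul_add, map_add]; exact add _ _ _ ihx ihy
    | mem_mul m hm i x hx ih =>
      obtain ⟨τ, rfl⟩ := hm
      have := mul _ _ _ _ (gen₂ τ) ih
      rw [Splitting.fn₂, ← map_mul, Algebra.TensorProduct.tmul_mul_tmul, one_mul] at this
      convert this using 1
      push_cast; ring
  have key : ∀ x ∈ splitDegree R G₁ G₂ k, P k (S.toEquiv x) := by
    intro x hx
    induction hx using Submodule.span_induction with
    | mem x hx =>
      obtain ⟨i, j, hij, x, hx, y, hy, rfl⟩ := hx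
      have := mul _ _ _ _ (h₁ i x hx) (h₂ j y hy)
      rw [← map_mul, Algebra.TensorProduct.tmul_mul_tmul, one_mul, mul_one, hij] at this
      exact this
    | zero => rw [map_zero]; exact zero k
    | add x y _ _ hx hy => rw [map_add]; exact add _ _ _ hx hy
    | smul r x _ hx =>
      rw [map_smul, Algebra.smul_def, ← zero_add k]
      exact mul _ _ _ _ (base r) hx
  have := key (S.toEquiv.symm a) ((S.degree k _).1 (by simpa using ha))
  simpa using this

theorem Splitting.fn₁_mem (τ : Module.Dual R G₁) : S.fn₁ τ ∈ 𝒜 1 :=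
  (S.degree 1 _).2 (Submodule.subset_span ⟨1, 0, by simp, _, by simp, 1, by simp, rfl⟩)

theorem Splitting.fn₂_mem (b : Module.Dual R G₂) : S.fn₂ b ∈ 𝒜 2 :=
  (S.degree 2 _).2 (Submodule.subset_span ⟨0, 1, by simp, 1, by simp, _, by simp, rfl⟩)

theorem Splitting.fn₂_mul_comm (b : Module.Dual R G₂) (a : A) : S.fn₂ b * a = a * S.fn₂ b := by
  obtain ⟨t, rfl⟩ := S.toEquiv.surjective a
  rw [Splitting.fn₂, ← map_mul, ← map_mul]
  congr 1
  induction t using TensorProduct.induction_on with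
  | zero => simp
  | tmul x y => simp [mul_comm]
  | add x y hx hy => rw [mul_add, add_mul, hx, hy]

theorem Splitting.fn₁_mul_fn₁ (τ τ' : Module.Dual R G₁) :
    S.fn₁ τ * S.fn₁ τ' = - (S.fn₁ τ' * S.fn₁ τ) := by
  rw [eq_neg_iff_add_eq_zero, Splitting.fn₁, Splitting.fn₁, ← map_mul, ← map_mul, ← map_add,
    Algebra.TensorProduct.tmul_mul_tmul, Algebra.TensorProduct.tmul_mul_tmul,
    ← TensorProduct.add_tmul, ExteriorAlgebra.ι_add_mul_swap, TensorProduct.zero_tmul, map_zero]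

theorem algebraMap_mem_zero [GradedAlgebra 𝒜] (r : R) : algebraMap R A r ∈ 𝒜 0 := SetLike.algebraMap_mem_graded 𝒜 r

/-- The homogeneous functions commute in the graded sense. -/
theorem Splitting.graded_comm (S : Splitting G₁ G₂ 𝒜) [GradedAlgebra 𝒜] {i k : ℤ} {a b : A} (ha : a ∈ 𝒜 i) (hb : b ∈ 𝒜 k) :
    a * b = (i * k).negOnePow • (b * a) := by
  -- Two inductions: first on `b` with a single odd generator on the left, then on `a`. Generators
  -- of degree 2 are central, so they need no such preparation.
  have h₁ : ∀ τ, S.fn₁ τ * b = k.negOnePow • (b * S.fn₁ τ) := by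
    intro τ
    refine S.homogeneous_induction (P := fun k b => S.fn₁ τ * b = k.negOnePow • (b * S.fn₁ τ))
      ?_ ?_ ?_ ?_ ?_ ?_ hb
    · simp
    · intro k a b ha hb; simp only [mul_add, add_mul, ha, hb, smul_add]
    · intro r; simp [Algebra.commutes]
    · intro τ'; simp [S.fn₁_mul_fn₁ τ τ']
    · intro b; simp [S.fn₂_mul_comm, Int.negOnePow_even _ even_two]
    · intro i j a b ha hb
      rw [← mul_assoc, ha, smul_mul_assoc, mul_assoc, hb, mul_smul_comm, smul_smul,
        Int.negOnePow_add, mul_assoc]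
  refine S.homogeneous_induction (P := fun i a => a * b = (i * k).negOnePow • (b * a))
    ?_ ?_ ?_ ?_ ?_ ?_ ha
  · simp
  · intro k a b ha hb; simp only [mul_add, add_mul, ha, hb, smul_add]
  · intro r; simp [Algebra.commutes]
  · intro τ; simp [h₁]
  · intro c; simp [S.fn₂_mul_comm, Int.negOnePow_even]
  · intro i j a c ha hc
    rw [mul_assoc, hc, mul_smul_comm, ← mul_assoc, ha, smul_mul_assoc, smul_smul,
      add_mul, Int.negOnePow_add, mul_assoc, mul_comm (Int.negOnePow _)]

end GradedSplitting

/-! ### Graded derivations are controlled by their values on generators. -/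

section VectorFieldsOfSplitting

variable {R : Type*} [CommRing R] [Algebra ℝ R] {G₁ : Type*} [AddCommGroup G₁] [Module R G₁]
  {G₂ : Type*} [AddCommGroup G₂] [Module R G₂] {A : Type*} [Ring A] [Algebra R A]
  [Algebra ℝ A] [IsScalarTower ℝ R A]
  {𝒜 : ℤ → Submodule R A} [GradedAlgebra 𝒜] (S : Splitting G₁ G₂ 𝒜)

theorem IsVectorField.map_algebraMap_mul {j : ℤ} {d : A →ₗ[ℝ] A} (h : IsVectorField 𝒜 j d)
    (r : R) (a : A) : d (algebraMap R A r * a) = d (algebraMap R A r) * a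
      + algebraMap R A r * d a := by
  simpa using h.2 0 _ (algebraMap_mem_zero r) a

theorem IsVectorField.map_smul {j : ℤ} {d : A →ₗ[ℝ] A} (h : IsVectorField 𝒜 j d)
    (r : R) (a : A) : d (r • a) = d (algebraMap R A r) * a + r • d a := by
  rw [Algebra.smul_def, h.map_algebraMap_mul, ← Algebra.smul_def]

/-- An operator that has degree `j` and satisfies the Leibniz rule on generators is a vector
field. -/
theorem Splitting.isVectorField_of_generators {j : ℤ} {d : A →ₗ[ℝ] A}
    (m₀ : ∀ r, d (algebraMap R A r) ∈ 𝒜 j) (m₁ : ∀ τ, d (S.fn₁ τ) ∈ 𝒜 (1 + j))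
    (m₂ : ∀ b, d (S.fn₂ b) ∈ 𝒜 (2 + j))
    (l₀ : ∀ r a, d (algebraMap R A r * a) = d (algebraMap R A r) * a + algebraMap R A r * d a)
    (l₁ : ∀ τ a, d (S.fn₁ τ * a) = d (S.fn₁ τ) * a + j.negOnePow • (S.fn₁ τ * d a))
    (l₂ : ∀ b a, d (S.fn₂ b * a) = d (S.fn₂ b) * a + S.fn₂ b * d a) :
    IsVectorField 𝒜 j d := by
  -- The Leibniz rule comes before the degree claim, since the degree of `d` on a product is read
  -- off from it.
  have h : ∀ i, ∀ ξ ∈ 𝒜 i, ∀ ζ, d (ξ * ζ) = d ξ * ζ + (j * i).negOnePow • (ξ * d ζ) := by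
    intro i ξ hξ
    refine S.homogeneous_induction (P := fun i ξ => ∀ ζ, d (ξ * ζ) = d ξ * ζ +
      (j * i).negOnePow • (ξ * d ζ)) ?_ ?_ ?_ ?_ ?_ ?_ hξ
    · simp
    · intro k a b ha hb ζ; simp only [add_mul, map_add, ha, hb, smul_add]; abel
    · intro r ζ; simp [l₀]
    · intro τ ζ; simp [l₁]
    · intro b ζ; simp [l₂, Int.negOnePow_even]
    · intro i k a b ha hb ζ
      rw [mul_assoc, ha, hb, ha b, mul_add j, Int.negOnePow_add]
      simp only [mul_add, add_mul, smul_add, smul_mul_assoc, mul_smul_comm, smul_smul, mul_assoc]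
      abel
  refine ⟨fun i ξ hξ => ?_, h⟩
  refine (S.homogeneous_induction (P := fun i ξ => ξ ∈ 𝒜 i ∧ d ξ ∈ 𝒜 (i + j))
    ?_ ?_ ?_ ?_ ?_ ?_ hξ).2
  · simp
  · intro k a b ha hb; rw [map_add]; exact ⟨add_mem ha.1 hb.1, add_mem ha.2 hb.2⟩
  · intro r; exact ⟨algebraMap_mem_zero r, by simpa using m₀ r⟩
  · intro τ; exact ⟨S.fn₁_mem τ, m₁ τ⟩
  · intro b; exact ⟨S.fn₂_mem b, m₂ b⟩
  · intro i k a b ha hb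
    refine ⟨SetLike.mul_mem_graded ha.1 hb.1, ?_⟩
    rw [h i a ha.1]
    refine add_mem ?_ ?_
    · convert SetLike.mul_mem_graded ha.2 hb.1 using 1; congr 1; ring
    · rw [Units.smul_def]
      refine zsmul_mem ?_ _
      convert SetLike.mul_mem_graded ha.1 hb.2 using 1; congr 1; ring

/-- A vector field that vanishes on generators vanishes. -/
theorem Splitting.vectorField_eq_zero {j : ℤ} {d : A →ₗ[ℝ] A} (h : IsVectorField 𝒜 j d)
    (h₀ : ∀ r, d (algebraMap R A r) = 0) (h₁ : ∀ τ, d (S.fn₁ τ) = 0) (h₂ : ∀ b, d (S.fn₂ b) = 0) :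
    d = 0 := by
  have key : ∀ i, ∀ a ∈ 𝒜 i, d a = 0 := by
    intro i a ha
    refine (S.homogeneous_induction (P := fun i a => a ∈ 𝒜 i ∧ d a = 0)
      ?_ ?_ ?_ ?_ ?_ ?_ ha).2
    · simp
    · intro k a b ha hb; rw [map_add]; exact ⟨add_mem ha.1 hb.1, by rw [ha.2, hb.2, add_zero]⟩
    · intro r; exact ⟨algebraMap_mem_zero r, h₀ r⟩
    · intro τ; exact ⟨S.fn₁_mem τ, h₁ τ⟩
    · intro b; exact ⟨S.fn₂_mem b, h₂ b⟩
    · intro i k a b ha hb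
      exact ⟨SetLike.mul_mem_graded ha.1 hb.1, by rw [h.2 i a ha.1, ha.2, hb.2]; simp⟩
  ext a
  induction a using DirectSum.Decomposition.inductionOn 𝒜 with
  | zero => simp
  | homogeneous a => exact key _ _ a.2
  | add a b ha hb => rw [map_add, ha, hb]; simp

theorem IsVectorField.add {j : ℤ} {d d' : A →ₗ[ℝ] A} (h : IsVectorField 𝒜 j d)
    (h' : IsVectorField 𝒜 j d') : IsVectorField 𝒜 j (d + d') := by
  refine ⟨fun i ξ hξ => add_mem (h.1 i ξ hξ) (h'.1 i ξ hξ), fun i ξ hξ ζ => ?_⟩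
  simp only [LinearMap.add_apply, h.2 i ξ hξ, h'.2 i ξ hξ, mul_add, add_mul, smul_add]
  abel

theorem IsVectorField.sub {j : ℤ} {d d' : A →ₗ[ℝ] A} (h : IsVectorField 𝒜 j d)
    (h' : IsVectorField 𝒜 j d') : IsVectorField 𝒜 j (d - d') := by
  refine ⟨fun i ξ hξ => sub_mem (h.1 i ξ hξ) (h'.1 i ξ hξ), fun i ξ hξ ζ => ?_⟩
  simp only [LinearMap.sub_apply, h.2 i ξ hξ, h'.2 i ξ hξ, mul_sub, sub_mul, smul_sub]
  abel

theorem IsVectorField.zero (j : ℤ) : IsVectorField 𝒜 j 0 := by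
  refine ⟨fun i ξ hξ => by simp, fun i ξ hξ ζ => by simp⟩

/-- Moving `a` past `ξ` costs the sign `(-1)^{ik}` by which the Leibniz rules of degrees `i + j` and
`j` differ. Graded commutativity is essential here. -/
theorem Splitting.isVectorField_smul (S : Splitting G₁ G₂ 𝒜) {i j : ℤ} {d : A →ₗ[ℝ] A} (h : IsVectorField 𝒜 j d)
    {a : A} (ha : a ∈ 𝒜 i) : IsVectorField 𝒜 (i + j) (a • d) := by
  refine ⟨fun k ξ hξ => ?_, fun k ξ hξ ζ => ?_⟩
  · have := SetLike.mul_mem_graded ha (h.1 k ξ hξ)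
    rw [LinearMap.smul_apply, smul_eq_mul]
    convert this using 1; congr 1; ring
  · simp only [LinearMap.smul_apply, smul_eq_mul, h.2 k ξ hξ, mul_add, mul_smul_comm]
    rw [← mul_assoc a ξ, S.graded_comm ha hξ, add_mul i, Int.negOnePow_add, mul_smul,
      smul_mul_assoc, mul_assoc, mul_assoc, smul_comm]

end VectorFieldsOfSplitting

/-! ### The vector fields `∇_X`, `q̂`, `β̂` and their values on generators. -/

section Generators

variable {R : Type*} [CommRing R] [Algebra ℝ R] {G₁ : Type*} [AddCommGroup G₁] [Module R G₁]
  {G₂ : Type*} [AddCommGroup G₂] [Module R G₂] {A : Type*} [Ring A] [Algebra R A]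
  [Algebra ℝ A] [IsScalarTower ℝ R A]
  {𝒜 : ℤ → Submodule R A} (S : Splitting G₁ G₂ 𝒜)
  (D₁ : Connection R G₁) (D₂ : Connection R G₂)

theorem Connection.cov_zero (D : Connection R G₁) (g : G₁) : (D.cov 0).toFun g = 0 := by
  have := D.smul_left 0 0 g
  rwa [zero_smul, zero_smul] at this

theorem Covering.ext_one {X : Derivation ℝ R R} (D : Covering X G₁) : D.ext.toFun 1 = 0 := by
  simpa using D.ext_algebraMap 1

theorem Covering.sym_one {X : Derivation ℝ R R} (D : Covering X G₁) : D.sym.toFun 1 = 0 := by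
  simpa using D.sym_algebraMap 1

theorem symContractₗ_mul (φ : Module.Dual R G₁) (x y : SymmetricAlgebra R G₁) :
    symContractₗ φ (x * y) = x * symContractₗ φ y + symContractₗ φ x * y :=
  symExtend_mul _ _ x y

theorem symContractₗ_ι (φ : Module.Dual R G₁) (g : G₁) :
    symContractₗ φ (SymmetricAlgebra.ι R G₁ g) = algebraMap R _ (φ g) :=
  symExtend_ι _ _ g

theorem symContractₗ_one (φ : Module.Dual R G₁) :
    symContractₗ φ (1 : SymmetricAlgebra R G₁) = 0 := by
  have : symContractₗ φ (algebraMap R (SymmetricAlgebra R G₁) 1) = _ := symExtend_algebraMap _ _ 1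
  simpa using this

theorem contractForm_one (q : G₁) : contractForm q (1 : ExteriorAlgebra R (Module.Dual R G₁)) = 0 :=
  CliffordAlgebra.contractLeft_one (Q := (0 : QuadraticForm R (Module.Dual R G₁)))
    (Module.Dual.eval R G₁ q)

theorem contractForm_ι_mul (q : G₁) (τ : Module.Dual R G₁)
    (x : ExteriorAlgebra R (Module.Dual R G₁)) :
    contractForm q (ExteriorAlgebra.ι R τ * x) =
      τ q • x - ExteriorAlgebra.ι R τ * contractForm q x :=
  CliffordAlgebra.contractLeft_ι_mul (Q := (0 : QuadraticForm R (Module.Dual R G₁)))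
    (d := Module.Dual.eval R G₁ q) τ x

theorem contractForm_ι (q : G₁) (τ : Module.Dual R G₁) :
    contractForm q (ExteriorAlgebra.ι R τ) = algebraMap R _ (τ q) :=
  CliffordAlgebra.contractLeft_ι (Q := (0 : QuadraticForm R (Module.Dual R G₁)))
    (Module.Dual.eval R G₁ q) τ

theorem hat₁_tmul (q : G₁) (x : ExteriorAlgebra R (Module.Dual R G₁))
    (y : SymmetricAlgebra R (Module.Dual R G₂)) :
    hat₁ (G₂ := G₂) q (x ⊗ₜ y) = contractForm q x ⊗ₜ y := rfl

theorem hat₂_tmul (β : G₂) (x : ExteriorAlgebra R (Module.Dual R G₁))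
    (y : SymmetricAlgebra R (Module.Dual R G₂)) :
    hat₂ (G₁ := G₁) β (x ⊗ₜ y) = x ⊗ₜ symContractₗ (Module.Dual.eval R G₂ β) y := rfl

theorem splitConnection_tmul (X : Derivation ℝ R R) (x : ExteriorAlgebra R (Module.Dual R G₁))
    (y : SymmetricAlgebra R (Module.Dual R G₂)) :
    ((splitConnection D₁ D₂).cov X).toFun (x ⊗ₜ y) =
      (D₁.dual.cov X).ext.toFun x ⊗ₜ y + x ⊗ₜ (D₂.dual.cov X).sym.toFun y := rfl

theorem splitConnection_mul (X : Derivation ℝ R R) (s t : SplitFun R G₁ G₂) :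
    ((splitConnection D₁ D₂).cov X).toFun (s * t) = ((splitConnection D₁ D₂).cov X).toFun s * t +
      s * ((splitConnection D₁ D₂).cov X).toFun t := by
  induction s using TensorProduct.induction_on with
  | zero => simp
  | add a b ha hb => simp only [add_mul, map_add, ha, hb]; abel
  | tmul x y =>
    induction t using TensorProduct.induction_on with
    | zero => simp
    | add a b ha hb => simp only [mul_add, map_add, ha, hb]; abel
    | tmul x' y' =>
      simp only [Algebra.TensorProduct.tmul_mul_tmul, splitConnection_tmul, Covering.ext_mul,
        Covering.sym_mul, add_mul, mul_add, TensorProduct.add_tmul, TensorProduct.tmul_add]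
      abel

theorem hat₁_ι_mul (q : G₁) (τ : Module.Dual R G₁) (t : SplitFun R G₁ G₂) :
    hat₁ q ((ExteriorAlgebra.ι R τ ⊗ₜ 1) * t) = τ q • t - (ExteriorAlgebra.ι R τ ⊗ₜ 1) * hat₁ q t := by
  induction t using TensorProduct.induction_on with
  | zero => simp
  | add a b ha hb => simp only [mul_add, map_add, ha, hb, smul_add]; abel
  | tmul x y =>
    simp only [Algebra.TensorProduct.tmul_mul_tmul, hat₁_tmul, contractForm_ι_mul, one_mul,
      TensorProduct.sub_tmul, TensorProduct.smul_tmul']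

theorem hat₁_sym_mul (q : G₁) (y : SymmetricAlgebra R (Module.Dual R G₂))
    (t : SplitFun R G₁ G₂) : hat₁ q ((1 ⊗ₜ y) * t) = (1 ⊗ₜ y) * hat₁ q t := by
  induction t using TensorProduct.induction_on with
  | zero => simp
  | add a b ha hb => simp only [mul_add, map_add, ha, hb]
  | tmul x z => simp only [Algebra.TensorProduct.tmul_mul_tmul, hat₁_tmul, one_mul]

theorem hat₂_ext_mul (β : G₂) (x : ExteriorAlgebra R (Module.Dual R G₁))
    (t : SplitFun R G₁ G₂) : hat₂ β ((x ⊗ₜ 1) * t) = (x ⊗ₜ 1) * hat₂ β t := by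
  induction t using TensorProduct.induction_on with
  | zero => simp
  | add a b ha hb => simp only [mul_add, map_add, ha, hb]
  | tmul x z => simp only [Algebra.TensorProduct.tmul_mul_tmul, hat₂_tmul, one_mul]

theorem hat₂_ι_mul (β : G₂) (b : Module.Dual R G₂) (t : SplitFun R G₁ G₂) :
    hat₂ β ((1 ⊗ₜ SymmetricAlgebra.ι R _ b) * t) =
      b β • t + (1 ⊗ₜ SymmetricAlgebra.ι R _ b) * hat₂ β t := by
  induction t using TensorProduct.induction_on with
  | zero => simp
  | add a b ha hb => simp only [mul_add, map_add, ha, hb, smul_add]; abel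
  | tmul x y =>
    simp only [Algebra.TensorProduct.tmul_mul_tmul, hat₂_tmul, symContractₗ_mul, symContractₗ_ι,
      one_mul, TensorProduct.tmul_add, Module.Dual.eval_apply, ← Algebra.smul_def,
      TensorProduct.tmul_smul]
    abel

theorem adToVectorField_apply (v : AdSpace R G₁ G₂) (t : SplitFun R G₁ G₂) :
    adToVectorField S D₁ D₂ v (S.toEquiv t) = S.toEquiv
      (((splitConnection D₁ D₂).cov v.1).toFun t + hat₁ v.2.1 t + hat₂ v.2.2 t) := by
  simp [adToVectorField]

theorem Splitting.map_form (θ : ExteriorAlgebra R (Module.Dual R G₁)) :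
    S.toEquiv (θ ⊗ₜ 1) = S.form θ := rfl

theorem adToVectorField_form (v : AdSpace R G₁ G₂) (θ : ExteriorAlgebra R (Module.Dual R G₁)) :
    adToVectorField S D₁ D₂ v (S.form θ) =
      S.form ((D₁.dual.cov v.1).ext.toFun θ + contractForm v.2.1 θ) := by
  rw [← S.map_form, ← S.map_form, adToVectorField_apply, splitConnection_tmul, Covering.sym_one,
    hat₁_tmul, hat₂_tmul, symContractₗ_one, TensorProduct.tmul_zero, add_zero,
    add_zero, TensorProduct.add_tmul]

theorem adToVectorField_algebraMap (v : AdSpace R G₁ G₂) (r : R) :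
    adToVectorField S D₁ D₂ v (algebraMap R A r) = algebraMap R A (v.1 r) := by
  have := adToVectorField_form S D₁ D₂ v (algebraMap R _ r)
  rw [Covering.ext_algebraMap, contractForm, CliffordAlgebra.contractLeft_algebraMap, add_zero]
    at this
  rwa [AlgHom.commutes, AlgHom.commutes] at this

theorem adToVectorField_fn₁ (v : AdSpace R G₁ G₂) (τ : Module.Dual R G₁) :
    adToVectorField S D₁ D₂ v (S.fn₁ τ) =
      S.fn₁ ((D₁.dual.cov v.1).toFun τ) + algebraMap R A (τ v.2.1) := by
  have := adToVectorField_form S D₁ D₂ v (ExteriorAlgebra.ι R τ)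
  rwa [Covering.ext_ι, contractForm_ι, map_add, AlgHom.commutes] at this

theorem adToVectorField_fn₂ (v : AdSpace R G₁ G₂) (b : Module.Dual R G₂) :
    adToVectorField S D₁ D₂ v (S.fn₂ b) =
      S.fn₂ ((D₂.dual.cov v.1).toFun b) + algebraMap R A (b v.2.2) := by
  rw [Splitting.fn₂, adToVectorField_apply, splitConnection_tmul, Covering.sym_ι, Covering.ext_one,
    hat₁_tmul, contractForm_one, hat₂_tmul, symContractₗ_ι, TensorProduct.zero_tmul,
    zero_add, add_zero, map_add,
    ← Algebra.TensorProduct.algebraMap_apply', AlgEquiv.commutes]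
  rfl

/-- `∇_X` and `β̂` are even while `q̂` is odd, so a mixed `v` obeys no single sign rule. The formula
is the even Leibniz rule, and the last term reverses the sign on the `Q` component. -/
theorem adToVectorField_fn₁_mul (v : AdSpace R G₁ G₂) (τ : Module.Dual R G₁) (a : A) :
    adToVectorField S D₁ D₂ v (S.fn₁ τ * a) =
      adToVectorField S D₁ D₂ v (S.fn₁ τ) * a + S.fn₁ τ * adToVectorField S D₁ D₂ v a
        - 2 • (S.fn₁ τ * adToVectorField S D₁ D₂ (0, v.2.1, 0) a) := by
  obtain ⟨t, rfl⟩ := S.toEquiv.surjective a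
  rw [adToVectorField_fn₁, Splitting.fn₁, Splitting.fn₁, ← map_mul, adToVectorField_apply, adToVectorField_apply,
    adToVectorField_apply, splitConnection_mul, hat₁_ι_mul, hat₂_ext_mul, splitConnection_tmul,
    Covering.ext_ι, Covering.sym_one]
  simp only [TensorProduct.tmul_zero, map_add, map_sub, map_mul, add_mul, mul_add, map_smul,
    Connection.cov_zero, ← Algebra.smul_def]
  simp only [hat₂, map_zero, LinearMap.lTensor_zero, LinearMap.zero_apply]
  simp only [two_smul, mul_zero, zero_mul, zero_add, add_zero]
  abel

theorem adToVectorField_fn₂_mul (v : AdSpace R G₁ G₂) (b : Module.Dual R G₂) (a : A) :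
    adToVectorField S D₁ D₂ v (S.fn₂ b * a) =
      adToVectorField S D₁ D₂ v (S.fn₂ b) * a + S.fn₂ b * adToVectorField S D₁ D₂ v a := by
  obtain ⟨t, rfl⟩ := S.toEquiv.surjective a
  rw [adToVectorField_fn₂, Splitting.fn₂, Splitting.fn₂, ← map_mul, adToVectorField_apply, adToVectorField_apply,
    splitConnection_mul, hat₁_sym_mul, hat₂_ι_mul, splitConnection_tmul,
    Covering.ext_one, Covering.sym_ι]
  simp only [TensorProduct.zero_tmul, map_add, map_mul, add_mul, mul_add, map_smul,
    ← Algebra.smul_def, zero_add]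
  abel

theorem adToVectorField_algebraMap_mul (v : AdSpace R G₁ G₂) (r : R) (a : A) :
    adToVectorField S D₁ D₂ v (algebraMap R A r * a) =
      adToVectorField S D₁ D₂ v (algebraMap R A r) * a +
        algebraMap R A r * adToVectorField S D₁ D₂ v a := by
  obtain ⟨t, rfl⟩ := S.toEquiv.surjective a
  rw [adToVectorField_algebraMap, ← Algebra.smul_def, ← Algebra.smul_def, ← Algebra.smul_def,
    ← map_smul, adToVectorField_apply, adToVectorField_apply, Covering.leibniz]
  simp only [map_smul, map_add, smul_add]
  abel

theorem adMap_tmul (a : A) (v : AdSpace R G₁ G₂) :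
    adMap S D₁ D₂ (a ⊗ₜ v) = a • adToVectorField S D₁ D₂ v := rfl

variable [GradedAlgebra 𝒜]

/-- The vector field of an element of degree `j` of `TM[0] ⊕ Q[1] ⊕ B^*[2]` has degree `-j`. -/
theorem adToVectorField_isVectorField {j : ℤ} {v : AdSpace R G₁ G₂}
    (hv : v ∈ adGrading R G₁ G₂ j) : IsVectorField 𝒜 (-j) (adToVectorField S D₁ D₂ v) := by
  obtain ⟨h₀, h₁, h₂⟩ := hv
  refine S.isVectorField_of_generators ?_ ?_ ?_ (adToVectorField_algebraMap_mul S D₁ D₂ v) ?_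
    (adToVectorField_fn₂_mul S D₁ D₂ v)
  · intro r
    rw [adToVectorField_algebraMap]
    rcases eq_or_ne j 0 with rfl | hj
    · exact algebraMap_mem_zero _
    · simp [h₀ hj]
  · intro τ
    rw [adToVectorField_fn₁]
    refine add_mem ?_ ?_
    · rcases eq_or_ne j 0 with rfl | hj
      · exact S.fn₁_mem _
      · rw [h₀ hj, Connection.cov_zero]; simp [Splitting.fn₁]
    · rcases eq_or_ne j 1 with rfl | hj
      · exact algebraMap_mem_zero _
      · simp [h₁ hj]
  · intro b
    rw [adToVectorField_fn₂]
    refine add_mem ?_ ?_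
    · rcases eq_or_ne j 0 with rfl | hj
      · exact S.fn₂_mem _
      · rw [h₀ hj, Connection.cov_zero]; simp [Splitting.fn₂]
    · rcases eq_or_ne j 2 with rfl | hj
      · exact algebraMap_mem_zero _
      · simp [h₂ hj]
  · intro τ a
    rw [adToVectorField_fn₁_mul]
    rcases eq_or_ne j 1 with rfl | hj
    · have : v = (0, v.2.1, 0) := by
        ext : 1
        · exact h₀ (by norm_num)
        · ext : 1
          · rfl
          · exact h₂ (by norm_num)
      rw [← this, Int.negOnePow_neg, Int.negOnePow_one, Units.neg_smul, one_smul, two_smul]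
      abel
    · rw [h₁ hj]
      have hz : ((0, 0, 0) : AdSpace R G₁ G₂) = 0 := rfl
      rw [hz, map_zero, LinearMap.zero_apply, mul_zero, smul_zero, sub_zero]
      -- Outside `j = 0, 1, 2` the graded piece is zero, so odd signs never arise here.
      have : Even (-j) ∨ v = 0 := by
        by_cases h : j = 0 ∨ j = 2
        · left; rcases h with rfl | rfl <;> decide
        · push Not at h
          right
          ext : 1
          · exact h₀ h.1
          · ext : 1
            · exact h₁ hj
            · exact h₂ h.2
      rcases this with h | rfl
      · rw [Int.negOnePow_even _ h, one_smul]
      · simp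

theorem adMap_isVectorField {p : ℤ} {w : A ⊗[R] AdSpace R G₁ G₂}
    (hw : w ∈ totalDegree 𝒜 (adGrading R G₁ G₂) p) :
    IsVectorField 𝒜 p (adMap S D₁ D₂ w) := by
  induction hw using Submodule.span_induction with
  | mem w hw =>
    obtain ⟨i, j, rfl, ξ, hξ, e, he, rfl⟩ := hw
    rw [adMap_tmul, sub_eq_add_neg]
    exact S.isVectorField_smul (adToVectorField_isVectorField S D₁ D₂ he) hξ
  | zero => rw [map_zero]; exact .zero p
  | add x y _ _ hx hy => rw [map_add]; exact hx.add hy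
  | smul r x _ hx =>
    rw [← algebraMap_smul A r x, map_smul]
    simpa using S.isVectorField_smul hx (algebraMap_mem_zero r)

end Generators

/-! ### Projectivity and finiteness of the function algebra over the base ring. -/

section Projective

variable {R : Type*} [CommRing R]

/-- Functoriality makes the exterior algebra of a retract of `R^n` a retract of the exterior algebra
of `R^n`, which is free. -/
theorem projective_exteriorAlgebra (G : Type*) [AddCommGroup G] [Module R G] [Module.Finite R G]
    [Module.Projective R G] : Module.Projective R (ExteriorAlgebra R G) := by
  obtain ⟨n, f, g, -, -, hfg⟩ := Module.Finite.exists_comp_eq_id_of_projective R G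
  have : Module.Free R (ExteriorAlgebra R (Fin n → R)) :=
    .of_basis (Pi.basisFun R (Fin n)).ExteriorAlgebra
  refine .of_split (ExteriorAlgebra.map g).toLinearMap (ExteriorAlgebra.map f).toLinearMap ?_
  rw [← AlgHom.comp_toLinearMap, ExteriorAlgebra.map_comp_map, hfg, ExteriorAlgebra.map_id]
  rfl

theorem projective_symmetricAlgebra (G : Type*) [AddCommGroup G] [Module R G] [Module.Finite R G]
    [Module.Projective R G] : Module.Projective R (SymmetricAlgebra R G) := by
  obtain ⟨n, f, g, -, -, hfg⟩ := Module.Finite.exists_comp_eq_id_of_projective R G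
  let i : SymmetricAlgebra R G →ₐ[R] SymmetricAlgebra R (Fin n → R) :=
    SymmetricAlgebra.lift (SymmetricAlgebra.ι R _ ∘ₗ g)
  let s : SymmetricAlgebra R (Fin n → R) →ₐ[R] SymmetricAlgebra R G :=
    SymmetricAlgebra.lift (SymmetricAlgebra.ι R _ ∘ₗ f)
  have h : s.comp i = AlgHom.id R _ := by
    refine SymmetricAlgebra.algHom_ext (LinearMap.ext fun x => ?_)
    have := LinearMap.congr_fun hfg x
    simp only [LinearMap.comp_apply, LinearMap.id_apply] at this
    simp [i, s, this]
  refine .of_split i.toLinearMap s.toLinearMap ?_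
  rw [← AlgHom.comp_toLinearMap, h]
  rfl

/-- The `e i` are the images of the standard basis under a surjection from `R^n`, and the `φ i` are
the coordinates of a section of it. -/
theorem exists_dual_basis (G : Type*) [AddCommGroup G] [Module R G] [Module.Finite R G]
    [Module.Projective R G] : ∃ (n : ℕ) (e : Fin n → G) (φ : Fin n → Module.Dual R G),
      ∀ g, ∑ i, φ i g • e i = g := by
  obtain ⟨n, f, g, -, -, hfg⟩ := Module.Finite.exists_comp_eq_id_of_projective R G
  refine ⟨n, fun i => f (fun j => if i = j then 1 else 0), fun i => LinearMap.proj i ∘ₗ g, fun x => ?_⟩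
  have h : f (g x) = x := LinearMap.congr_fun hfg x
  rw [f.pi_apply_eq_sum_univ (g x)] at h
  exact h

variable [Algebra ℝ R] {G₁ : Type*} [AddCommGroup G₁] [Module R G₁]
  {G₂ : Type*} [AddCommGroup G₂] [Module R G₂]
  [Module.Finite R G₁] [Module.Projective R G₁] [Module.Finite R G₂] [Module.Projective R G₂]

theorem splitDegree_fg (p : ℤ) : (splitDegree R G₁ G₂ p).FG := by
  -- Since `i + 2j = p` bounds both exponents by `p`, only finitely many pairs contribute; for
  -- negative `p` the filter leaves none.
  have : splitDegree R G₁ G₂ p = ⨆ ij ∈ (Finset.range (p.toNat + 1) ×ˢ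
      Finset.range (p.toNat + 1)).filter (fun ij => (ij.1 : ℤ) + 2 * ij.2 = p),
      Submodule.map₂ (TensorProduct.mk R _ _) (⋀[R]^ij.1 (Module.Dual R G₁))
        (LinearMap.range (SymmetricAlgebra.ι R (Module.Dual R G₂)) ^ ij.2) := by
    refine le_antisymm (Submodule.span_le.2 ?_) (iSup₂_le fun ij hij => ?_)
    · rintro _ ⟨i, j, hij, x, hx, y, hy, rfl⟩
      refine Submodule.mem_iSup_of_mem (i, j) (Submodule.mem_iSup_of_mem ?_
        (Submodule.apply_mem_map₂ (TensorProduct.mk R _ _) hx hy))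
      simp only [Finset.mem_filter, Finset.mem_product, Finset.mem_range]
      omega
    · rw [Submodule.map₂_le]
      intro x hx y hy
      exact Submodule.subset_span ⟨ij.1, ij.2, (Finset.mem_filter.1 hij).2, x, hx, y, hy, rfl⟩
  rw [this]
  refine Submodule.fg_biSup _ _ fun ij _ => Submodule.FG.map₂ _ (.pow ?_ _) (.pow ?_ _)
  · rw [LinearMap.range_eq_map]; exact Module.Finite.fg_top.map _
  · rw [LinearMap.range_eq_map]; exact Module.Finite.fg_top.map _

variable {A : Type*} [Ring A] [Algebra R A] {𝒜 : ℤ → Submodule R A} (S : Splitting G₁ G₂ 𝒜)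

theorem Splitting.projective (S : Splitting G₁ G₂ 𝒜) : Module.Projective R A := by
  have := projective_exteriorAlgebra (R := R) (Module.Dual R G₁)
  have := projective_symmetricAlgebra (R := R) (Module.Dual R G₂)
  exact .of_equiv S.toEquiv.toLinearEquiv

theorem Splitting.finite (S : Splitting G₁ G₂ 𝒜) (p : ℤ) : Module.Finite R (𝒜 p) := by
  have : 𝒜 p = (splitDegree R G₁ G₂ p).map S.toEquiv.toLinearMap := by
    ext a
    obtain ⟨t, rfl⟩ := S.toEquiv.surjective a
    rw [S.degree]
    simp
  rw [Module.Finite.iff_fg, this]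
  exact (splitDegree_fg p).map _

/-- Each degree is a direct summand of the projective module `A`. -/
theorem Splitting.projective_degree (S : Splitting G₁ G₂ 𝒜) [GradedAlgebra 𝒜] (p : ℤ) :
    Module.Projective R (𝒜 p) := by
  have := S.projective
  refine .of_split (𝒜 p).subtype
    (DirectSum.component R ℤ (fun i => 𝒜 i) p ∘ₗ (DirectSum.decomposeLinearEquiv 𝒜).toLinearMap) ?_
  ext x
  simp [← DirectSum.apply_eq_component]

end Projective

/-! ### Separating elements of tensor products by pairings. -/

section Bijective

variable {R : Type*} [CommRing R] [Algebra ℝ R] {G₁ : Type*} [AddCommGroup G₁] [Module R G₁]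
  {G₂ : Type*} [AddCommGroup G₂] [Module R G₂]
  [Module.Finite R G₁] [Module.Projective R G₁] [Module.Finite R G₂] [Module.Projective R G₂]
  {A : Type*} [Ring A] [Algebra R A]
  [Algebra ℝ A] [IsScalarTower ℝ R A]
  {𝒜 : ℤ → Submodule R A} (S : Splitting G₁ G₂ 𝒜)
  (D₁ : Connection R G₁) (D₂ : Connection R G₂)

/-- The evaluation `a ⊗ g ↦ f(g) a`. -/
def pairing (A : Type*) [Ring A] [Algebra R A] {V : Type*} [AddCommGroup V] [Module R V]
    (f : Module.Dual R V) : A ⊗[R] V →ₗ[R] A :=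
  TensorProduct.rid R A ∘ₗ f.lTensor A

theorem pairing_tmul {V : Type*} [AddCommGroup V] [Module R V] (f : Module.Dual R V) (a : A)
    (v : V) : pairing A f (a ⊗ₜ v) = f v • a := by
  simp [pairing]

/-- Evaluation of derivations at a function. -/
def derivEval (r : R) : Module.Dual R (Derivation ℝ R R) where
  toFun X := X r
  map_add' _ _ := rfl
  map_smul' _ _ := rfl

/-- An element of `A ⊗ Der(R)`, with `A` projective, is determined by its values on `R`. -/
theorem tensor_derivation_eq_zero [Module.Projective R A] (u : A ⊗[R] Derivation ℝ R R)
    (h : ∀ r, pairing A (derivEval r) u = 0) : u = 0 := by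
  classical
  obtain ⟨s, hs⟩ := Module.projective_def'.1 (inferInstance : Module.Projective R A)
  -- Projectivity embeds `A` as a summand of the free module `A →₀ R`. There `u` becomes a finite
  -- family of derivations, which can be tested on functions one by one; no finiteness of the module
  -- of derivations is needed.
  let c : A ⊗[R] Derivation ℝ R R →ₗ[R] (A →₀ Derivation ℝ R R) :=
    (TensorProduct.finsuppScalarLeft R (Derivation ℝ R R) A).toLinearMap ∘ₗ s.rTensor _
  have hc : ∀ u r a, c u a r = s (pairing A (derivEval r) u) a := by
    intro u r a
    induction u using TensorProduct.induction_on with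
    | zero => simp
    | add x y hx hy => simp [hx, hy]
    | tmul b X => simp [c, pairing_tmul, derivEval, TensorProduct.finsuppScalarLeft_apply_tmul_apply, mul_comm]
  have hc0 : c u = 0 := by
    ext a r
    rw [hc, h]; simp
  have h1 : s.rTensor (Derivation ℝ R R) u = 0 :=
    (TensorProduct.finsuppScalarLeft R (Derivation ℝ R R) A).map_eq_zero_iff.1 hc0
  have h2 : (Finsupp.linearCombination R id).rTensor (Derivation ℝ R R)
      (s.rTensor (Derivation ℝ R R) u) = u := by
    rw [← LinearMap.comp_apply, ← LinearMap.rTensor_comp, hs, LinearMap.rTensor_id,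
      LinearMap.id_apply]
  rw [← h2, h1, map_zero]

/-- An element of `A ⊗ G` is determined by its pairings with `G^*`. -/
theorem tensor_eq_zero_of_dual (u : A ⊗[R] G₁)
    (h : ∀ τ, pairing A τ u = 0) : u = 0 := by
  obtain ⟨n, e, φ, he⟩ := exists_dual_basis (R := R) G₁
  -- The dual basis expands `u` with coefficients that are themselves pairings.
  have : u = ∑ i, pairing A (φ i) u ⊗ₜ e i := by
    clear h
    induction u using TensorProduct.induction_on with
    | zero => simp
    | add x y hx hy =>
      conv_lhs => rw [hx, hy]
      simp [TensorProduct.add_tmul, Finset.sum_add_distrib]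
    | tmul b q =>
      simp only [pairing_tmul, TensorProduct.smul_tmul]
      rw [← TensorProduct.tmul_sum, he]
  rw [this]
  simp [h]

end Bijective

/-! ### The map `μ_∇` is bijective onto the vector fields and matches degrees. -/

section Bijective

variable {R : Type*} [CommRing R] [Algebra ℝ R] {G₁ : Type*} [AddCommGroup G₁] [Module R G₁]
  {G₂ : Type*} [AddCommGroup G₂] [Module R G₂]
  [Module.Finite R G₁] [Module.Projective R G₁] [Module.Finite R G₂] [Module.Projective R G₂]
  {A : Type*} [Ring A] [Algebra R A]
  [Algebra ℝ A] [IsScalarTower ℝ R A]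
  {𝒜 : ℤ → Submodule R A} (S : Splitting G₁ G₂ 𝒜)
  (D₁ : Connection R G₁) (D₂ : Connection R G₂)

/-- The inclusion of the summand `A ⊗ Γ(TM)`. -/
def inTM (A : Type*) [Ring A] [Algebra R A] (G₁ : Type*) [AddCommGroup G₁] [Module R G₁]
    (G₂ : Type*) [AddCommGroup G₂] [Module R G₂] :
    A ⊗[R] Derivation ℝ R R →ₗ[R] A ⊗[R] AdSpace R G₁ G₂ :=
  (LinearMap.inl R (Derivation ℝ R R) (G₁ × G₂)).lTensor A

/-- The inclusion of the summand `A ⊗ Γ(Q)`. -/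
def inQ (A : Type*) [Ring A] [Algebra R A] (G₁ : Type*) [AddCommGroup G₁] [Module R G₁]
    (G₂ : Type*) [AddCommGroup G₂] [Module R G₂] : A ⊗[R] G₁ →ₗ[R] A ⊗[R] AdSpace R G₁ G₂ :=
  (LinearMap.inr R (Derivation ℝ R R) (G₁ × G₂) ∘ₗ LinearMap.inl R G₁ G₂).lTensor A

/-- The inclusion of the summand `A ⊗ Γ(B^*)`. -/
def inB (A : Type*) [Ring A] [Algebra R A] (G₁ : Type*) [AddCommGroup G₁] [Module R G₁]
    (G₂ : Type*) [AddCommGroup G₂] [Module R G₂] : A ⊗[R] G₂ →ₗ[R] A ⊗[R] AdSpace R G₁ G₂ :=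
  (LinearMap.inr R (Derivation ℝ R R) (G₁ × G₂) ∘ₗ LinearMap.inr R G₁ G₂).lTensor A

theorem eq_inTM_add_inQ_add_inB (w : A ⊗[R] AdSpace R G₁ G₂) :
    ∃ (u₀ : A ⊗[R] Derivation ℝ R R) (u₁ : A ⊗[R] G₁) (u₂ : A ⊗[R] G₂),
      w = inTM A G₁ G₂ u₀ + inQ A G₁ G₂ u₁ + inB A G₁ G₂ u₂ := by
  induction w using TensorProduct.induction_on with
  | zero => exact ⟨0, 0, 0, by simp⟩
  | add x y hx hy =>
    obtain ⟨u₀, u₁, u₂, rfl⟩ := hx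
    obtain ⟨v₀, v₁, v₂, rfl⟩ := hy
    exact ⟨u₀ + v₀, u₁ + v₁, u₂ + v₂, by simp only [map_add]; abel⟩
  | tmul a v =>
    refine ⟨a ⊗ₜ v.1, a ⊗ₜ v.2.1, a ⊗ₜ v.2.2, ?_⟩
    simp [inTM, inQ, inB, ← TensorProduct.tmul_add]

/-- This and the following evaluations are the triangular form of `μ_∇`: each summand pairs with its
own generators, and the `Q` and `B^*` summands vanish on the generators of the summands before them.
-/
theorem adMap_inTM_algebraMap (u : A ⊗[R] Derivation ℝ R R) (r : R) :
    adMap S D₁ D₂ (inTM A G₁ G₂ u) (algebraMap R A r) = pairing A (derivEval r) u := by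
  induction u using TensorProduct.induction_on with
  | zero => simp
  | add x y hx hy => simp only [map_add, LinearMap.add_apply, hx, hy]
  | tmul a X =>
    rw [pairing_tmul, inTM, LinearMap.lTensor_tmul, adMap_tmul, LinearMap.smul_apply,
      adToVectorField_algebraMap, smul_eq_mul, ← Algebra.commutes, ← Algebra.smul_def]
    rfl

theorem adMap_inQ_algebraMap (u : A ⊗[R] G₁) (r : R) :
    adMap S D₁ D₂ (inQ A G₁ G₂ u) (algebraMap R A r) = 0 := by
  induction u using TensorProduct.induction_on with
  | zero => simp
  | add x y hx hy => simp only [map_add, LinearMap.add_apply, hx, hy, add_zero]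
  | tmul a q => simp [inQ, adMap_tmul, adToVectorField_algebraMap]

theorem adMap_inB_algebraMap (u : A ⊗[R] G₂) (r : R) :
    adMap S D₁ D₂ (inB A G₁ G₂ u) (algebraMap R A r) = 0 := by
  induction u using TensorProduct.induction_on with
  | zero => simp
  | add x y hx hy => simp only [map_add, LinearMap.add_apply, hx, hy, add_zero]
  | tmul a q => simp [inB, adMap_tmul, adToVectorField_algebraMap]

theorem Splitting.fn₁_zero : S.fn₁ 0 = 0 := by simp [Splitting.fn₁]

theorem Splitting.fn₂_zero : S.fn₂ 0 = 0 := by simp [Splitting.fn₂]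

theorem adMap_inQ_fn₁ (u : A ⊗[R] G₁) (τ : Module.Dual R G₁) :
    adMap S D₁ D₂ (inQ A G₁ G₂ u) (S.fn₁ τ) = pairing A τ u := by
  induction u using TensorProduct.induction_on with
  | zero => simp
  | add x y hx hy => simp only [map_add, LinearMap.add_apply, hx, hy]
  | tmul a q =>
    rw [pairing_tmul, inQ, LinearMap.lTensor_tmul, adMap_tmul, LinearMap.smul_apply,
      adToVectorField_fn₁, smul_eq_mul]
    simp [Connection.cov_zero, S.fn₁_zero, ← Algebra.commutes, ← Algebra.smul_def]

theorem adMap_inB_form (u : A ⊗[R] G₂) (θ : ExteriorAlgebra R (Module.Dual R G₁)) :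
    adMap S D₁ D₂ (inB A G₁ G₂ u) (S.form θ) = 0 := by
  induction u using TensorProduct.induction_on with
  | zero => simp
  | add x y hx hy => simp only [map_add, LinearMap.add_apply, hx, hy, add_zero]
  | tmul a q =>
    have : ((D₁.dual.cov 0).ext).toFun θ = 0 := D₁.dual.ext.cov_zero θ
    simp [inB, adMap_tmul, adToVectorField_form, this, contractForm]

theorem adMap_inB_fn₁ (u : A ⊗[R] G₂) (τ : Module.Dual R G₁) :
    adMap S D₁ D₂ (inB A G₁ G₂ u) (S.fn₁ τ) = 0 :=
  adMap_inB_form S D₁ D₂ u _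

theorem adMap_inB_fn₂ (u : A ⊗[R] G₂) (b : Module.Dual R G₂) :
    adMap S D₁ D₂ (inB A G₁ G₂ u) (S.fn₂ b) = pairing A b u := by
  induction u using TensorProduct.induction_on with
  | zero => simp
  | add x y hx hy => simp only [map_add, LinearMap.add_apply, hx, hy]
  | tmul a q =>
    rw [pairing_tmul, inB, LinearMap.lTensor_tmul, adMap_tmul, LinearMap.smul_apply,
      adToVectorField_fn₂, smul_eq_mul]
    simp [Connection.cov_zero, S.fn₂_zero, ← Algebra.commutes, ← Algebra.smul_def]

/-- `μ_∇(w)` determines `w`, already through its values on generators. -/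
theorem eq_zero_of_adMap_generators {w : A ⊗[R] AdSpace R G₁ G₂}
    (h₀ : ∀ r, adMap S D₁ D₂ w (algebraMap R A r) = 0)
    (h₁ : ∀ τ, adMap S D₁ D₂ w (S.fn₁ τ) = 0) (h₂ : ∀ b, adMap S D₁ D₂ w (S.fn₂ b) = 0) :
    w = 0 := by
  have := S.projective
  obtain ⟨u₀, u₁, u₂, rfl⟩ := eq_inTM_add_inQ_add_inB w
  -- The order matters: a nonzero `TM` component also acts on `Γ(Q^*)` and `Γ(B)`, so it has to be
  -- eliminated first.
  have e₀ : u₀ = 0 := tensor_derivation_eq_zero u₀ fun r => by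
    simpa [adMap_inTM_algebraMap, adMap_inQ_algebraMap, adMap_inB_algebraMap] using h₀ r
  subst e₀
  have e₁ : u₁ = 0 := tensor_eq_zero_of_dual u₁ fun τ => by
    simpa [adMap_inQ_fn₁, adMap_inB_fn₁] using h₁ τ
  subst e₁
  have e₂ : u₂ = 0 := tensor_eq_zero_of_dual u₂ fun b => by
    simpa [adMap_inB_fn₂] using h₂ b
  simp [e₂]

theorem adMap_injective : Function.Injective (adMap S D₁ D₂) := by
  refine (injective_iff_map_eq_zero _).2 fun w hw =>
    eq_zero_of_adMap_generators S D₁ D₂ ?_ ?_ ?_ <;> simp [hw]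

variable [GradedAlgebra 𝒜]

theorem IsVectorField.map_algebraMap_mem {p : ℤ} {d : A →ₗ[ℝ] A} (hd : IsVectorField 𝒜 p d)
    (r : R) : d (algebraMap R A r) ∈ 𝒜 p := by
  simpa using hd.1 0 _ (algebraMap_mem_zero r)

/-- The derivation `r ↦ φ(d r)` of `R`, for a vector field `d` of degree `p` and a functional `φ`
on the functions of degree `p`. -/
def IsVectorField.baseDerivation {p : ℤ} {d : A →ₗ[ℝ] A} (hd : IsVectorField 𝒜 p d)
    (φ : Module.Dual R (𝒜 p)) : Derivation ℝ R R :=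
  Derivation.mk'
    { toFun := fun r => φ ⟨d (algebraMap R A r), hd.map_algebraMap_mem r⟩
      map_add' := fun r s => by
        rw [← map_add]; congr 1; ext; simp
      map_smul' := fun c r => by
        rw [RingHom.id_apply, ← algebraMap_smul R c (φ _), ← φ.map_smul]
        congr 1; ext
        simp [Algebra.algebraMap_eq_smul_one] }
    (fun r s => by
      simp only [LinearMap.coe_mk, AddHom.coe_mk]
      rw [← φ.map_smul, ← φ.map_smul, ← φ.map_add]
      congr 1; ext
      simp only [map_mul, hd.map_algebraMap_mul, Submodule.coe_add, Submodule.coe_smul]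
      rw [← Algebra.smul_def, Algebra.smul_def s, Algebra.commutes s, add_comm])

theorem tmul_mem_totalDegree {V : Type*} [AddCommGroup V] [Module R V] {E : ℤ → Submodule R V}
    {i j p : ℤ} (h : i - j = p) {a : A} (ha : a ∈ 𝒜 i) {v : V} (hv : v ∈ E j) :
    a ⊗ₜ v ∈ totalDegree 𝒜 E p :=
  Submodule.subset_span ⟨i, j, h, a, ha, v, hv, rfl⟩

/-- Every vector field is in the image of `μ_∇`. -/
theorem exists_adMap_eq {p : ℤ} {d : A →ₗ[ℝ] A} (hd : IsVectorField 𝒜 p d) :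
    ∃ w ∈ totalDegree 𝒜 (adGrading R G₁ G₂) p, adMap S D₁ D₂ w = d := by
  obtain ⟨w₀, hw₀, h₀⟩ : ∃ w ∈ totalDegree 𝒜 (adGrading R G₁ G₂) p, ∀ r,
      adMap S D₁ D₂ w (algebraMap R A r) = d (algebraMap R A r) := by
    have := S.projective_degree p
    have := S.finite p
    -- On `R`, `d` is a derivation with values in the finitely generated projective module `𝒜 p`.
    -- Expanding those values in a dual basis gives coefficients that are derivations of `R`, hence
    -- elements of the `TM` component.
    obtain ⟨n, e, φ, he⟩ := exists_dual_basis (R := R) (𝒜 p)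
    refine ⟨∑ k, (e k : A) ⊗ₜ ((hd.baseDerivation (φ k), 0, 0) : AdSpace R G₁ G₂),
      sum_mem fun k _ => tmul_mem_totalDegree (sub_zero p) (e k).2 ?_, fun r => ?_⟩
    · simp [adGrading]
    · have := congrArg Subtype.val (he ⟨d (algebraMap R A r), hd.map_algebraMap_mem r⟩)
      refine Eq.trans ?_ this
      simp only [map_sum, LinearMap.sum_apply, adMap_tmul, LinearMap.smul_apply,
        adToVectorField_algebraMap, AddSubmonoidClass.coe_finsetSum, Submodule.coe_smul]
      refine Finset.sum_congr rfl fun k _ => ?_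
      rw [Algebra.smul_def, smul_eq_mul, Algebra.commutes]
      rfl
  obtain ⟨w₁, hw₁, h₁₀, h₁⟩ : ∃ w ∈ totalDegree 𝒜 (adGrading R G₁ G₂) p,
      (∀ r, adMap S D₁ D₂ w (algebraMap R A r) = 0) ∧
      ∀ τ, adMap S D₁ D₂ w (S.fn₁ τ) = (d - adMap S D₁ D₂ w₀) (S.fn₁ τ) := by
    have hd' := hd.sub (adMap_isVectorField S D₁ D₂ hw₀)
    set d' := d - adMap S D₁ D₂ w₀
    -- With its values on `R` removed, the field is `R`-linear, so a dual basis determines it on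
    -- `Γ(Q^*)`.
    have hl : ∀ (r : R) a, d' (r • a) = r • d' a := fun r a => by
      rw [hd'.map_smul, LinearMap.sub_apply, h₀, sub_self, zero_mul, zero_add]
    obtain ⟨n, e, φ, he⟩ := exists_dual_basis (R := R) G₁
    refine ⟨inQ A G₁ G₂ (∑ k, d' (S.fn₁ (φ k)) ⊗ₜ e k), ?_, ?_, fun τ => ?_⟩
    · rw [map_sum]
      refine sum_mem fun k _ => tmul_mem_totalDegree (i := 1 + p) (j := 1) (by ring)
        (hd'.1 1 _ (S.fn₁_mem _)) ?_
      simp [adGrading]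
    · exact adMap_inQ_algebraMap S D₁ D₂ _
    · have : τ = ∑ k, τ (e k) • φ k := by
        ext g
        conv_lhs => rw [← he g]
        simp [mul_comm]
      rw [adMap_inQ_fn₁]
      conv_rhs => rw [this]
      have hf : ∀ x, S.fn₁ x = S.form.toLinearMap (ExteriorAlgebra.ι R x) := fun _ => rfl
      simp only [map_sum, pairing_tmul, hf, map_smul, hl]
  obtain ⟨w₂, hw₂, h₂₀, h₂₁, h₂⟩ : ∃ w ∈ totalDegree 𝒜 (adGrading R G₁ G₂) p,
      (∀ r, adMap S D₁ D₂ w (algebraMap R A r) = 0) ∧ (∀ τ, adMap S D₁ D₂ w (S.fn₁ τ) = 0) ∧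
      ∀ b, adMap S D₁ D₂ w (S.fn₂ b) = (d - adMap S D₁ D₂ (w₀ + w₁)) (S.fn₂ b) := by
    have hd' := hd.sub (adMap_isVectorField S D₁ D₂ (add_mem hw₀ hw₁))
    -- The `Q` correction vanishes on `R`, so the new remainder is still `R`-linear.
    have hl : ∀ (r : R) a, (d - adMap S D₁ D₂ (w₀ + w₁)) (r • a) =
        r • (d - adMap S D₁ D₂ (w₀ + w₁)) a := fun r a => by
      rw [hd'.map_smul, LinearMap.sub_apply, map_add, LinearMap.add_apply, h₀, h₁₀, add_zero,
        sub_self, zero_mul, zero_add]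
    set d' := d - adMap S D₁ D₂ (w₀ + w₁)
    obtain ⟨n, e, φ, he⟩ := exists_dual_basis (R := R) G₂
    refine ⟨inB A G₁ G₂ (∑ k, d' (S.fn₂ (φ k)) ⊗ₜ e k), ?_, ?_, ?_, fun τ => ?_⟩
    · rw [map_sum]
      refine sum_mem fun k _ => tmul_mem_totalDegree (i := 2 + p) (j := 2) (by ring)
        (hd'.1 2 _ (S.fn₂_mem _)) ?_
      simp [adGrading]
    · exact adMap_inB_algebraMap S D₁ D₂ _
    · exact adMap_inB_fn₁ S D₁ D₂ _
    · have : τ = ∑ k, τ (e k) • φ k := by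
        ext g
        conv_lhs => rw [← he g]
        simp [mul_comm]
      rw [adMap_inB_fn₂]
      conv_rhs => rw [this]
      have hf : ∀ x, S.fn₂ x = (S.toEquiv.toLinearMap ∘ₗ
        TensorProduct.mk R _ _ 1 ∘ₗ SymmetricAlgebra.ι R _) x := fun _ => rfl
      simp only [map_sum, pairing_tmul, hf, map_smul, hl]
  have hw := add_mem (add_mem hw₀ hw₁) hw₂
  refine ⟨_, hw, (sub_eq_zero.1 (S.vectorField_eq_zero
    (hd.sub (adMap_isVectorField S D₁ D₂ hw)) ?_ ?_ ?_)).symm⟩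
  · intro r
    simp [h₀, h₁₀, h₂₀]
  · intro τ
    simp [h₁, h₂₁]
  · intro b
    have := h₂ b
    simp only [map_add, LinearMap.sub_apply, LinearMap.add_apply] at this ⊢
    rw [this]; abel

/-- Surjectivity gives a preimage of the right degree, and injectivity says that it is `w`. -/
theorem isVectorField_adMap_iff (p : ℤ) (w : A ⊗[R] AdSpace R G₁ G₂) :
    IsVectorField 𝒜 p (adMap S D₁ D₂ w) ↔ w ∈ totalDegree 𝒜 (adGrading R G₁ G₂) p := by
  refine ⟨fun h => ?_, adMap_isVectorField S D₁ D₂⟩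
  obtain ⟨w', hw', e⟩ := exists_adMap_eq S D₁ D₂ h
  rwa [← adMap_injective S D₁ D₂ e]

/-- Allows additive identities whose signs depend on the degree to be checked on homogeneous
elements only. -/
theorem mem_span_totalDegree (w : A ⊗[R] AdSpace R G₁ G₂) :
    w ∈ ⨆ p, totalDegree 𝒜 (adGrading R G₁ G₂) p := by
  have h : ∀ (i : ℤ) (a : A), a ∈ 𝒜 i → ∀ v : AdSpace R G₁ G₂,
      a ⊗ₜ v ∈ ⨆ p, totalDegree 𝒜 (adGrading R G₁ G₂) p := by
    intro i a ha v
    have : v = (v.1, 0, 0) + (0, v.2.1, 0) + (0, 0, v.2.2) := by simp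
    rw [this, TensorProduct.tmul_add, TensorProduct.tmul_add]
    refine add_mem (add_mem ?_ ?_) ?_
    · exact Submodule.mem_iSup_of_mem _ (tmul_mem_totalDegree (j := 0) rfl ha (by simp [adGrading]))
    · exact Submodule.mem_iSup_of_mem _ (tmul_mem_totalDegree (j := 1) rfl ha (by simp [adGrading]))
    · exact Submodule.mem_iSup_of_mem _ (tmul_mem_totalDegree (j := 2) rfl ha (by simp [adGrading]))
  induction w using TensorProduct.induction_on with
  | zero => exact zero_mem _
  | add x y hx hy => exact add_mem hx hy
  | tmul a v =>
    induction a using DirectSum.Decomposition.inductionOn 𝒜 with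
    | zero => simp
    | homogeneous a => exact h _ _ a.2 v
    | add a b ha hb => rw [TensorProduct.add_tmul]; exact add_mem ha hb

theorem range_adMap : LinearMap.range (adMap S D₁ D₂) = vectorFields 𝒜 := by
  refine le_antisymm ?_ (Submodule.span_le.2 ?_)
  · rintro _ ⟨w, rfl⟩
    refine Submodule.iSup_induction _ (motive := fun w => adMap S D₁ D₂ w ∈ vectorFields 𝒜)
      (mem_span_totalDegree (𝒜 := 𝒜) w) ?_ ?_ ?_
    · intro p w hw
      exact Submodule.subset_span ⟨p, adMap_isVectorField S D₁ D₂ hw⟩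
    · simp
    · intro x y hx hy
      rw [map_add]; exact add_mem hx hy
  · rintro d ⟨p, hd⟩
    obtain ⟨w, -, rfl⟩ := exists_adMap_eq S D₁ D₂ hd
    exact ⟨w, rfl⟩

end Bijective

/-! ### The commutator with `Q` and its transport along `μ_∇`. -/

section AdjointRep

variable {R : Type*} [CommRing R] [Algebra ℝ R] {G₁ : Type*} [AddCommGroup G₁] [Module R G₁]
  {G₂ : Type*} [AddCommGroup G₂] [Module R G₂]
  [Module.Finite R G₁] [Module.Projective R G₁] [Module.Finite R G₂] [Module.Projective R G₂]
  {A : Type*} [Ring A] [Algebra R A]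
  [Algebra ℝ A] [IsScalarTower ℝ R A]
  {𝒜 : ℤ → Submodule R A} (S : Splitting G₁ G₂ 𝒜)
  (D₁ : Connection R G₁) (D₂ : Connection R G₂)

/-- The parity automorphism, `ξ ↦ (-1)^{|ξ|} ξ`. -/
def Splitting.parity : A →ₐ[R] A :=
  S.toEquiv.toAlgHom.comp ((Algebra.TensorProduct.map
    (CliffordAlgebra.involute (Q := (0 : QuadraticForm R (Module.Dual R G₁))))
    (AlgHom.id R (SymmetricAlgebra R (Module.Dual R G₂)))).comp S.toEquiv.symm.toAlgHom)

theorem Splitting.parity_apply {i : ℤ} {a : A} (ha : a ∈ 𝒜 i) :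
    S.parity a = i.negOnePow • a := by
  refine S.homogeneous_induction (P := fun i a => S.parity a = i.negOnePow • a)
    ?_ ?_ ?_ ?_ ?_ ?_ ha
  · simp
  · intro k a b ha hb; rw [map_add, ha, hb, smul_add]
  · intro r; simp
  · intro τ
    have : CliffordAlgebra.involute (Q := (0 : QuadraticForm R (Module.Dual R G₁)))
        (ExteriorAlgebra.ι R τ) = - ExteriorAlgebra.ι R τ := CliffordAlgebra.involute_ι τ
    simp [Splitting.parity, Splitting.fn₁, this, TensorProduct.neg_tmul]
  · intro b
    simp [Splitting.parity, Splitting.fn₂, Int.negOnePow_even _ even_two]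
  · intro i j a b ha hb
    rw [map_mul, ha, hb, smul_mul_assoc, mul_smul_comm, smul_smul, Int.negOnePow_add]

variable (Q : HomologicalVectorField 𝒜)

/-- The graded commutator with `Q`. -/
def Splitting.bracket : (A →ₗ[ℝ] A) →ₗ[ℝ] (A →ₗ[ℝ] A) where
  toFun d := Q.toFun ∘ₗ d - (S.parity.toLinearMap.restrictScalars ℝ) ∘ₗ d ∘ₗ
    (S.parity.toLinearMap.restrictScalars ℝ) ∘ₗ Q.toFun
  map_add' d d' := by
    ext a
    simp
    abel
  map_smul' c d := by
    ext a
    simp [smul_sub]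
    rw [← algebraMap_smul R c, map_smul, algebraMap_smul]

theorem Splitting.bracket_apply (d : A →ₗ[ℝ] A) (a : A) :
    S.bracket Q d a = Q.toFun (d a) - S.parity (d (S.parity (Q.toFun a))) := rfl

variable [GradedAlgebra 𝒜]

theorem linearMap_ext_homogeneous {d d' : A →ₗ[ℝ] A} (h : ∀ i, ∀ a ∈ 𝒜 i, d a = d' a) :
    d = d' := by
  ext a
  induction a using DirectSum.Decomposition.inductionOn 𝒜 with
  | zero => simp
  | homogeneous a => exact h _ _ a.2
  | add a b ha hb => rw [map_add, ha, hb, map_add]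

/-- `Q` has odd degree. This anticommutation is what makes the cross terms of the double bracket
cancel. -/
theorem Splitting.parity_Q (a : A) : S.parity (Q.toFun a) = - Q.toFun (S.parity a) := by
  refine LinearMap.congr_fun (f := (S.parity.toLinearMap.restrictScalars ℝ) ∘ₗ Q.toFun)
    (g := -(Q.toFun ∘ₗ (S.parity.toLinearMap.restrictScalars ℝ)))
    (linearMap_ext_homogeneous (𝒜 := 𝒜) fun i a ha => ?_) a
  rcases Int.units_eq_one_or i.negOnePow with h | h <;>
  simp [S.parity_apply ha, S.parity_apply (Q.isVectorField.1 i a ha), Int.negOnePow_succ, h]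

/-- Conjugating an operator of degree `p` by the parity multiplies it by `(-1)^p`. The bracket is
therefore defined on all operators, with no reference to a degree, and agrees with the graded
commutator on homogeneous ones. -/
theorem Splitting.bracket_of_isVectorField {p : ℤ} {d : A →ₗ[ℝ] A}
    (hd : IsVectorField 𝒜 p d) :
    S.bracket Q d = Q.toFun ∘ₗ d - p.negOnePow • (d ∘ₗ Q.toFun) := by
  refine linearMap_ext_homogeneous (𝒜 := 𝒜) fun i a ha => ?_
  have h1 := Q.isVectorField.1 i a ha
  rw [S.bracket_apply, S.parity_apply h1, Units.smul_def, map_zsmul, map_zsmul,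
    S.parity_apply (hd.1 _ _ h1), Int.negOnePow_add _ p]
  rcases Int.units_eq_one_or (i + 1).negOnePow with h | h <;>
  rcases Int.units_eq_one_or p.negOnePow with h' | h' <;> simp [h, h']

/-- The mixed terms, with one operator on each factor, cancel in pairs. All signs depend only on the
parities of `p`, `i` and `p * i`, so a finite case check suffices. -/
theorem bracket_isVectorField {p : ℤ} {d : A →ₗ[ℝ] A} (hd : IsVectorField 𝒜 p d) :
    IsVectorField 𝒜 (p + 1) (Q.toFun ∘ₗ d - p.negOnePow • (d ∘ₗ Q.toFun)) := by
  obtain ⟨hd₁, hd₂⟩ := hd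
  obtain ⟨hQ₁, hQ₂⟩ := Q.isVectorField
  refine ⟨fun i ξ hξ => ?_, fun i ξ hξ ζ => ?_⟩
  · simp only [LinearMap.sub_apply, LinearMap.comp_apply, LinearMap.smul_apply, Units.smul_def]
    refine sub_mem ?_ (zsmul_mem ?_ _)
    · convert hQ₁ _ _ (hd₁ i ξ hξ) using 1; congr 1; ring
    · convert hd₁ _ _ (hQ₁ i ξ hξ) using 1; congr 1; ring
  · simp only [LinearMap.sub_apply, LinearMap.comp_apply, LinearMap.smul_apply,
      hd₂ i ξ hξ, hQ₂ i ξ hξ, map_add, Units.smul_def, map_zsmul, hQ₂ _ _ (hd₁ i ξ hξ),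
      hd₂ _ _ (hQ₁ i ξ hξ), one_mul, mul_add, add_mul, mul_one, Int.negOnePow_add]
    rcases Int.units_eq_one_or p.negOnePow with h | h <;>
    rcases Int.units_eq_one_or i.negOnePow with h' | h' <;>
    rcases Int.units_eq_one_or (p * i).negOnePow with h'' | h'' <;>
    simp [h, h', h'', sub_mul, mul_sub, add_mul, mul_add] <;> abel

theorem Splitting.bracket_adMap_mem (w : A ⊗[R] AdSpace R G₁ G₂) :
    S.bracket Q (adMap S D₁ D₂ w) ∈ LinearMap.range (adMap S D₁ D₂) := by
  refine Submodule.iSup_induction _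
    (motive := fun w => S.bracket Q (adMap S D₁ D₂ w) ∈ LinearMap.range (adMap S D₁ D₂))
    (mem_span_totalDegree (𝒜 := 𝒜) w) ?_ ?_ ?_
  · intro p w hw
    have h := adMap_isVectorField S D₁ D₂ hw
    rw [S.bracket_of_isVectorField Q h]
    obtain ⟨w', -, h'⟩ := exists_adMap_eq S D₁ D₂ (bracket_isVectorField Q h)
    exact ⟨w', h'⟩
  · simp
  · intro x y hx hy
    rw [map_add, map_add]; exact add_mem hx hy

/-- Uses only the Leibniz rule of `Q` and multiplicativity of the parity; `d` may be any operator.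
Through `μ_∇` it becomes the Leibniz rule of the adjoint representation. -/
theorem Splitting.bracket_smul {i : ℤ} {ξ : A} (hξ : ξ ∈ 𝒜 i) (d : A →ₗ[ℝ] A) :
    S.bracket Q (ξ • d) = Q.toFun ξ • d + i.negOnePow • (ξ • S.bracket Q d) := by
  ext a
  simp only [S.bracket_apply, LinearMap.smul_apply, LinearMap.add_apply, smul_eq_mul,
    Q.isVectorField.2 i ξ hξ, map_mul, S.parity_apply hξ, mul_sub, smul_sub, smul_mul_assoc,
    one_mul]
  abel

/-- The terms containing `Q²` vanish, after moving a parity if necessary, and the two terms with `Q`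
on both sides of `d` cancel by `parity_Q`. -/
theorem Splitting.bracket_bracket (d : A →ₗ[ℝ] A) : S.bracket Q (S.bracket Q d) = 0 := by
  ext a
  simp [S.bracket_apply, Q.sq_zero, S.parity_Q]

theorem adMap_real_smul (c : ℝ) (w : A ⊗[R] AdSpace R G₁ G₂) :
    adMap S D₁ D₂ (c • w) = c • adMap S D₁ D₂ w :=
  LinearMap.map_smul_of_tower _ _ _

/-- The operator `μ_∇⁻¹ ∘ [Q, ·] ∘ μ_∇`. -/
def adjointDifferential (w : A ⊗[R] AdSpace R G₁ G₂) : A ⊗[R] AdSpace R G₁ G₂ :=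
  (S.bracket_adMap_mem D₁ D₂ Q w).choose

theorem adMap_adjointDifferential (w : A ⊗[R] AdSpace R G₁ G₂) :
    adMap S D₁ D₂ (adjointDifferential S D₁ D₂ Q w) = S.bracket Q (adMap S D₁ D₂ w) :=
  (S.bracket_adMap_mem D₁ D₂ Q w).choose_spec

/-- The adjoint representation. -/
def adjointRep : RepUpToHomotopy Q (adGrading R G₁ G₂) where
  D :=
    { toFun := adjointDifferential S D₁ D₂ Q
      map_add' := fun x y => adMap_injective S D₁ D₂ (by
        simp only [map_add, adMap_adjointDifferential])
      map_smul' := fun c x => adMap_injective S D₁ D₂ (by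
        simp only [adMap_real_smul, adMap_adjointDifferential, map_smul, RingHom.id_apply]) }
  degree p w hw := by
    rw [← isVectorField_adMap_iff S D₁ D₂]
    have h := adMap_isVectorField S D₁ D₂ hw
    have := bracket_isVectorField Q h
    rwa [← S.bracket_of_isVectorField Q h, ← adMap_adjointDifferential] at this
  leibniz i ξ hξ w := adMap_injective S D₁ D₂ (by
    simp only [LinearMap.coe_mk, AddHom.coe_mk]
    rw [adMap_adjointDifferential, map_smul, S.bracket_smul Q hξ, map_add,
      map_smul, Units.smul_def, Units.smul_def, map_zsmul, map_smul, adMap_adjointDifferential])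
  sq_zero w := adMap_injective S D₁ D₂ (by
    simp only [LinearMap.coe_mk, AddHom.coe_mk]
    rw [adMap_adjointDifferential, adMap_adjointDifferential, S.bracket_bracket, map_zero])

theorem adjointRep_isAdjointRep : IsAdjointRep S D₁ D₂ (adjointRep S D₁ D₂ Q) := by
  intro p w hw
  rw [← S.bracket_of_isVectorField Q (adMap_isVectorField S D₁ D₂ hw)]
  exact adMap_adjointDifferential S D₁ D₂ Q w

theorem existsUnique_adjointRep :
    ∃! ρ : RepUpToHomotopy Q (adGrading R G₁ G₂), IsAdjointRep S D₁ D₂ ρ := by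
  refine ⟨adjointRep S D₁ D₂ Q, adjointRep_isAdjointRep S D₁ D₂ Q, fun ρ hρ => ?_⟩
  have : ρ.D = (adjointRep S D₁ D₂ Q).D := by
    ext1 w
    refine Submodule.iSup_induction _ (motive := fun w => ρ.D w = (adjointRep S D₁ D₂ Q).D w)
      (mem_span_totalDegree (𝒜 := 𝒜) w) ?_ ?_ ?_
    · intro p w hw
      refine adMap_injective S D₁ D₂ ?_
      rw [hρ p w hw, adjointRep_isAdjointRep S D₁ D₂ Q p w hw]
    · simp
    · intro x y hx hy
      rw [map_add, map_add, hx, hy]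
  cases ρ
  simp only at this
  subst this
  rfl

variable {G₁' : Type*} [AddCommGroup G₁'] [Module R G₁']
  {G₂' : Type*} [AddCommGroup G₂'] [Module R G₂']
  [Module.Finite R G₁'] [Module.Projective R G₁'] [Module.Finite R G₂'] [Module.Projective R G₂']
  (S' : Splitting G₁' G₂' 𝒜) (D₁' : Connection R G₁') (D₂' : Connection R G₂') {Q}

/-- The isomorphism `μ_∇'⁻¹ ∘ μ_∇` of adjoint representations. -/
theorem exists_repIso {ρ : RepUpToHomotopy Q (adGrading R G₁ G₂)}
    {ρ' : RepUpToHomotopy Q (adGrading R G₁' G₂')} (hρ : IsAdjointRep S D₁ D₂ ρ)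
    (hρ' : IsAdjointRep S' D₁' D₂' ρ') :
    ∃ e : RepIso ρ ρ', ∀ w, adMap S' D₁' D₂' (e.toEquiv w) = adMap S D₁ D₂ w := by
  -- Both maps are injective with the same image, the module of vector fields, which involves
  -- neither splittings nor connections.
  let e : (A ⊗[R] AdSpace R G₁ G₂) ≃ₗ[A] (A ⊗[R] AdSpace R G₁' G₂') :=
    (LinearEquiv.ofInjective _ (adMap_injective S D₁ D₂)).trans
      ((LinearEquiv.ofEq _ _ ((range_adMap S D₁ D₂).trans (range_adMap S' D₁' D₂').symm)).trans
        (LinearEquiv.ofInjective _ (adMap_injective S' D₁' D₂')).symm)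
  have he : ∀ w, adMap S' D₁' D₂' (e w) = adMap S D₁ D₂ w := fun w => by
    simp only [e, LinearEquiv.trans_apply]
    rw [← LinearEquiv.ofInjective_apply (h := adMap_injective S' D₁' D₂'),
      LinearEquiv.apply_symm_apply]
    rfl
  have hdeg : ∀ p w, e w ∈ totalDegree 𝒜 (adGrading R G₁' G₂') p ↔
      w ∈ totalDegree 𝒜 (adGrading R G₁ G₂) p := fun p w => by
    rw [← isVectorField_adMap_iff S' D₁' D₂', ← isVectorField_adMap_iff S D₁ D₂, he]
  refine ⟨⟨e, hdeg, fun w => ?_⟩, he⟩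
  refine Submodule.iSup_induction _ (motive := fun w => e (ρ.D w) = ρ'.D (e w))
    (mem_span_totalDegree (𝒜 := 𝒜) w) ?_ ?_ ?_
  · intro p w hw
    refine adMap_injective S' D₁' D₂' ?_
    rw [he, hρ p w hw, hρ' p _ ((hdeg p w).2 hw), he]
  · simp
  · intro x y hx hy
    rw [map_add, map_add, map_add, map_add, hx, hy]

end AdjointRep

/-! ### Explicit comparison under a change of splitting. -/

section ChangeOfSplitting

variable {R : Type*} [CommRing R] [Algebra ℝ R] {G₁ : Type*} [AddCommGroup G₁] [Module R G₁]
  {G₂ : Type*} [AddCommGroup G₂] [Module R G₂]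
  {A : Type*} [Ring A] [Algebra R A]
  [Algebra ℝ A] [IsScalarTower ℝ R A]
  {𝒜 : ℤ → Submodule R A} {S₁ S₂ : Splitting G₁ G₂ 𝒜} {σ : TwoForm R G₁ G₂}
  (D₁ : Connection R G₁) (D₂ : Connection R G₂)

theorem IsChangeOfSplitting.form_eq (h : IsChangeOfSplitting S₁ S₂ σ) : S₁.form = S₂.form :=
  ExteriorAlgebra.hom_ext (LinearMap.ext h.1)

theorem TwoForm.incl_neg (σ : TwoForm R G₁ G₂) : (-σ).incl = -σ.incl :=
  map_neg ((Submodule.subtype _).rTensor G₂) σ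

theorem TwoForm.pullback_neg (σ : TwoForm R G₁ G₂) (b : Module.Dual R G₂) :
    (-σ).pullback b = -σ.pullback b := by
  simp [TwoForm.pullback, TwoForm.incl_neg]

theorem IsChangeOfSplitting.symm (h : IsChangeOfSplitting S₁ S₂ σ) :
    IsChangeOfSplitting S₂ S₁ (-σ) := by
  refine ⟨fun τ => (h.1 τ).symm, fun b => ?_⟩
  rw [h.2, TwoForm.pullback_neg, map_neg, h.form_eq]
  abel

/-- The splitting enters `changeMap` only through its embedding of `Q`-forms, which a change of
splitting leaves fixed. -/
theorem IsChangeOfSplitting.changeMap_eq (h : IsChangeOfSplitting S₁ S₂ σ)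
    (σ' : TwoForm R G₁ G₂) : changeMap S₁ D₁ D₂ σ' = changeMap S₂ D₁ D₂ σ' := by
  have : (formToAd S₁ : _ →ₗ[R] A ⊗[R] AdSpace R G₁ G₂) = formToAd S₂ := by
    rw [formToAd, formToAd, h.form_eq]
  unfold changeMap
  congr 1
  refine LinearMap.ext fun v => ?_
  simp only [changeOnGenerators, this]

theorem changeOnGenerators_apply (S : Splitting G₁ G₂ 𝒜) (v : AdSpace R G₁ G₂) :
    changeOnGenerators S D₁ D₂ σ v = 1 ⊗ₜ[R] v + formToAd S
      ((contractForm v.2.1).rTensor G₂ σ.incl + ((D₁.dual.ext.tensor D₂).cov v.1).toFun σ.incl) := by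
  rw [map_add, ← add_assoc]
  rfl

theorem formToAd_eq (S : Splitting G₁ G₂ 𝒜) (η : ExteriorAlgebra R (Module.Dual R G₁) ⊗[R] G₂) :
    formToAd S η = inB A G₁ G₂ (S.form.toLinearMap.rTensor G₂ η) := by
  induction η using TensorProduct.induction_on with
  | zero => simp
  | add x y hx hy => simp only [map_add, hx, hy]
  | tmul x y => simp [formToAd, inB]

theorem pairing_form (S : Splitting G₁ G₂ 𝒜) (b : Module.Dual R G₂)
    (η : ExteriorAlgebra R (Module.Dual R G₁) ⊗[R] G₂) :
    pairing A b (S.form.toLinearMap.rTensor G₂ η) = S.form (pairing _ b η) := by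
  induction η using TensorProduct.induction_on with
  | zero => simp
  | add x y hx hy => simp only [map_add, hx, hy]
  | tmul x y => simp [pairing_tmul]

theorem pairing_contractForm (q : G₁) (b : Module.Dual R G₂)
    (η : ExteriorAlgebra R (Module.Dual R G₁) ⊗[R] G₂) :
    pairing _ b ((contractForm q).rTensor G₂ η) = contractForm q (pairing _ b η) := by
  induction η using TensorProduct.induction_on with
  | zero => simp
  | add x y hx hy => simp only [map_add, hx, hy]
  | tmul x y => simp [pairing_tmul]

/-- The product rule for the contraction, `⟨∇_X η, b⟩ = ∇_X ⟨η, b⟩ - ⟨η, ∇_X b⟩`; it is where `∇_X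
σ` emerges from comparing the two fields. -/
theorem pairing_cov (X : Derivation ℝ R R) (b : Module.Dual R G₂)
    (η : ExteriorAlgebra R (Module.Dual R G₁) ⊗[R] G₂) :
    pairing _ b (((D₁.dual.ext.tensor D₂).cov X).toFun η) =
      (D₁.dual.cov X).ext.toFun (pairing _ b η) - pairing _ ((D₂.dual.cov X).toFun b) η := by
  induction η using TensorProduct.induction_on with
  | zero => simp
  | add x y hx hy => simp only [map_add, hx, hy]; abel
  | tmul x y =>
    have h1 : ((D₁.dual.ext.tensor D₂).cov X).toFun (x ⊗ₜ y) =
      (D₁.dual.cov X).ext.toFun x ⊗ₜ y + x ⊗ₜ (D₂.cov X).toFun y := rfl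
    have h2 : (D₂.dual.cov X).toFun b y = X (b y) - b ((D₂.cov X).toFun y) := rfl
    rw [h1, map_add, pairing_tmul, pairing_tmul, pairing_tmul, pairing_tmul, h2,
      Covering.leibniz, sub_smul]
    abel

variable [Module.Finite R G₁] [Module.Projective R G₁] [Module.Finite R G₂]
  [Module.Projective R G₂] [GradedAlgebra 𝒜]

/-- The fields of `v` for the two splittings agree on `C^∞(M)` and on `Γ(Q^*)`. On the
`S₂`-generator of `b`, the first minus the second is `⟨σ, ∇_X b⟩ - ∇_X ⟨σ, b⟩ - i_q ⟨σ, b⟩ = -⟨∇_X σ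
+ i_q σ, b⟩`, which is the action of a `B^*`-valued form. -/
theorem IsChangeOfSplitting.adMap_changeOnGenerators (h : IsChangeOfSplitting S₁ S₂ σ)
    (v : AdSpace R G₁ G₂) :
    adMap S₂ D₁ D₂ (changeOnGenerators S₁ D₁ D₂ (-σ) v) = adToVectorField S₁ D₁ D₂ v := by
  set η := (contractForm v.2.1).rTensor G₂ (-σ).incl +
    ((D₁.dual.ext.tensor D₂).cov v.1).toFun (-σ).incl with hη
  have e : adMap S₂ D₁ D₂ (changeOnGenerators S₁ D₁ D₂ (-σ) v) = adToVectorField S₂ D₁ D₂ v +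
      adMap S₂ D₁ D₂ (inB A G₁ G₂ (S₂.form.toLinearMap.rTensor G₂ η)) := by
    rw [← h.form_eq, ← formToAd_eq, changeOnGenerators_apply, map_add, adMap_tmul, one_smul]
  -- Writing the `S₁` field as an `S₂` image turns the claim into the vanishing of a tensor, which
  -- can be tested on generators.
  obtain ⟨w, hw⟩ : adMap S₁ D₁ D₂ (1 ⊗ₜ v) ∈ LinearMap.range (adMap S₂ D₁ D₂) := by
    rw [range_adMap, ← range_adMap S₁ D₁ D₂]; exact ⟨_, rfl⟩
  rw [adMap_tmul, one_smul] at hw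
  have key : changeOnGenerators S₁ D₁ D₂ (-σ) v - w = 0 := by
    refine eq_zero_of_adMap_generators S₂ D₁ D₂ (fun r => ?_) (fun τ => ?_) (fun b => ?_)
    · rw [map_sub, e, hw]
      simp [adToVectorField_algebraMap, adMap_inB_algebraMap]
    · rw [map_sub, e, hw, LinearMap.sub_apply, LinearMap.add_apply, adMap_inB_fn₁, ← h.1,
        adToVectorField_fn₁, h.1, adToVectorField_fn₁, h.1]
      abel
    · have hb : S₂.fn₂ b = S₁.fn₂ b - S₁.form (σ.pullback b) := by rw [h.2, h.form_eq]; abel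
      have hp : σ.pullback = fun b => pairing _ b σ.incl := rfl
      rw [map_sub, e, hw, LinearMap.sub_apply, LinearMap.add_apply, adMap_inB_fn₂, pairing_form,
        adToVectorField_fn₂, hb, map_sub, adToVectorField_fn₂, adToVectorField_form, h.2,
        h.form_eq, hη, TwoForm.incl_neg, map_neg, map_neg, map_add, map_neg, map_neg,
        pairing_contractForm, pairing_cov, hp]
      simp only [map_add, map_neg, map_sub]
      abel
  rw [sub_eq_zero.1 key, hw]

theorem IsChangeOfSplitting.adMap_changeMap (h : IsChangeOfSplitting S₁ S₂ σ)
    (w : A ⊗[R] AdSpace R G₁ G₂) :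
    adMap S₂ D₁ D₂ (changeMap S₁ D₁ D₂ (-σ) w) = adMap S₁ D₁ D₂ w := by
  induction w using TensorProduct.induction_on with
  | zero => simp
  | add x y hx hy => simp only [map_add, hx, hy]
  | tmul a v =>
    rw [changeMap, extendLinear_tmul, map_smul, h.adMap_changeOnGenerators, adMap_tmul]

theorem IsChangeOfSplitting.exists_repIso (h : IsChangeOfSplitting S₁ S₂ σ)
    {Q : HomologicalVectorField 𝒜} {ρ₁ ρ₂ : RepUpToHomotopy Q (adGrading R G₁ G₂)}
    (h₁ : IsAdjointRep S₁ D₁ D₂ ρ₁) (h₂ : IsAdjointRep S₂ D₁ D₂ ρ₂) :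
    ∃ e : RepIso ρ₁ ρ₂, (∀ w, e.toEquiv w = changeMap S₁ D₁ D₂ (-σ) w) ∧
      (∀ w, e.toEquiv.symm w = changeMap S₁ D₁ D₂ σ w) ∧
      ∀ w, adMap S₂ D₁ D₂ (e.toEquiv w) = adMap S₁ D₁ D₂ w := by
  obtain ⟨e, he⟩ := LieTwo.exists_repIso S₁ D₁ D₂ S₂ D₁ D₂ h₁ h₂
  refine ⟨e, fun w => adMap_injective S₂ D₁ D₂ ?_, fun w => adMap_injective S₁ D₁ D₂ ?_, he⟩
  · rw [he, h.adMap_changeMap]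
  · rw [← he, LinearEquiv.apply_symm_apply, h.changeMap_eq]
    have := h.symm.adMap_changeMap D₁ D₂ w
    have hn : - -σ = σ := neg_neg σ
    rw [hn] at this
    exact this.symm

end ChangeOfSplitting

section Spanning

open Set Filter Topology Module

variable {E : Type*} [NormedAddCommGroup E] [NormedSpace ℝ E] [FiniteDimensional ℝ E]
  {M : Type*} [TopologicalSpace M] [ChartedSpace E M] [IsManifold 𝓘(ℝ, E) ∞ M]
  [T2Space M] [SigmaCompactSpace M]
  {F : Type*} [NormedAddCommGroup F] [NormedSpace ℝ F] [FiniteDimensional ℝ F]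
  {V : M → Type*} [TopologicalSpace (TotalSpace F V)] [∀ x, TopologicalSpace (V x)]
  [∀ x, AddCommGroup (V x)] [∀ x, Module ℝ (V x)] [FiberBundle F V] [VectorBundle ℝ F V]
  [ContMDiffVectorBundle ∞ F V 𝓘(ℝ, E)]

/-- The sections `s i` span the fibre over `x`. -/
def SpansAt {ι : Type*} (s : ι → Cₛ^∞⟮𝓘(ℝ, E); F, V⟯) (x : M) : Prop :=
  Submodule.span ℝ (range fun i => s i x) = ⊤

theorem contMDiffOn_linearMapAt (e : Trivialization F (π F V)) [MemTrivializationAtlas e]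
    (s : Cₛ^∞⟮𝓘(ℝ, E); F, V⟯) :
    ContMDiffOn 𝓘(ℝ, E) 𝓘(ℝ, F) ∞ (fun x => e.linearMapAt ℝ x (s x)) e.baseSet :=
  ((e.contMDiffOn_section_baseSet_iff (IB := 𝓘(ℝ, E))).1 s.contMDiff.contMDiffOn).congr
    fun x hx => by rw [e.coe_linearMapAt_of_mem hx]

theorem exists_spansAt_nhds (x₀ : M) : ∃ s : Fin (finrank ℝ F) → Cₛ^∞⟮𝓘(ℝ, E); F, V⟯,
    ∀ᶠ x in 𝓝 x₀, SpansAt s x := by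
  let e := trivializationAt F V x₀
  let b := finBasis ℝ F
  have hb : e.baseSet ∈ 𝓝 x₀ := e.open_baseSet.mem_nhds (mem_baseSet_trivializationAt F V x₀)
  obtain ⟨f, hf, -⟩ := ((SmoothBumpFunction.nhds_basis_support (I := 𝓘(ℝ, E)) hb).mem_iff).1 hb
  have hs : ∀ i, CMDiff ∞ (T% ((f : M → ℝ) • e.localFrame b i)) := fun i =>
    ContMDiffOn.smul_section_of_tsupport f.contMDiff.contMDiffOn e.open_baseSet hf
      (e.contMDiffOn_localFrame_baseSet ∞ b i)
  refine ⟨fun i => ⟨_, hs i⟩, ?_⟩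
  filter_upwards [f.eventuallyEq_one, hb] with x hx hxe
  have := (e.isLocalFrameOn_localFrame_baseSet 𝓘(ℝ, E) ∞ b).generating hxe
  rw [SpansAt, eq_top_iff]
  refine this.trans (Submodule.span_mono ?_)
  rintro _ ⟨i, rfl⟩
  refine ⟨i, ?_⟩
  change f x • e.localFrame b i x = _
  rw [hx]; simp

theorem exists_spansAt_of_isCompact {K : Set M} (hK : IsCompact K) :
    ∃ (m : ℕ) (s : Fin m → Cₛ^∞⟮𝓘(ℝ, E); F, V⟯), ∀ x ∈ K, SpansAt s x := by
  refine hK.induction_on (p := fun K => ∃ (m : ℕ) (s : Fin m → Cₛ^∞⟮𝓘(ℝ, E); F, V⟯),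
    ∀ x ∈ K, SpansAt s x) ⟨0, fun _ => 0, by simp⟩ ?_ ?_ ?_
  · rintro s t hst ⟨m, s, h⟩
    exact ⟨m, s, fun x hx => h x (hst hx)⟩
  · rintro K L ⟨m, s, hs⟩ ⟨n, t, ht⟩
    refine ⟨m + n, Fin.append s t, fun x hx => ?_⟩
    rw [SpansAt, eq_top_iff]
    rcases hx with hx | hx
    · refine (hs x hx).ge.trans (Submodule.span_mono ?_)
      rintro _ ⟨i, rfl⟩
      exact ⟨Fin.castAdd n i, by simp⟩
    · refine (ht x hx).ge.trans (Submodule.span_mono ?_)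
      rintro _ ⟨i, rfl⟩
      exact ⟨Fin.natAdd m i, by simp⟩
  · intro x hx
    obtain ⟨s, hs⟩ := exists_spansAt_nhds (E := E) (F := F) (V := V) x
    exact ⟨_, mem_nhdsWithin_of_mem_nhds hs, _, s, fun y hy => hy⟩

/-- The values `φ(s_i(x))`, for points `x` near `x₀` and functionals `φ` on the fibre, form a set
of dimension at most `dim M + rank V`. -/
theorem exists_nhds_dimH_le {m : ℕ} (s : Fin m → Cₛ^∞⟮𝓘(ℝ, E); F, V⟯) (x₀ : M) :
    ∃ U ∈ 𝓝 x₀, dimH {c : Fin m → ℝ | ∃ x ∈ U, ∃ φ : Dual ℝ (V x), ∀ i, c i = φ (s i x)} ≤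
      (finrank ℝ E + finrank ℝ F : ℕ) := by
  let e := trivializationAt F V x₀
  let χ := chartAt E x₀
  have hO : IsOpen (χ.target ∩ χ.symm ⁻¹' e.baseSet) :=
    χ.isOpen_inter_preimage_symm e.open_baseSet
  have hx₀ : χ x₀ ∈ χ.target ∩ χ.symm ⁻¹' e.baseSet :=
    ⟨χ.map_source (mem_chart_source E x₀), by
      rw [mem_preimage, χ.left_inv (mem_chart_source E x₀)]
      exact mem_baseSet_trivializationAt F V x₀⟩
  obtain ⟨r, hr, hball⟩ := Metric.isOpen_iff.1 hO _ hx₀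
  let f : E × (F →L[ℝ] ℝ) → Fin m → ℝ :=
    fun p i => p.2 (e.linearMapAt ℝ (χ.symm p.1) (s i (χ.symm p.1)))
  have hf : ContDiffOn ℝ 1 f (Metric.ball (χ x₀) r ×ˢ univ) := by
    rw [contDiffOn_pi]
    intro i
    have h1 : ContDiffOn ℝ ∞ (fun y => e.linearMapAt ℝ (χ.symm y) (s i (χ.symm y)))
        (Metric.ball (χ x₀) r) := by
      rw [← contMDiffOn_iff_contDiffOn]
      exact (contMDiffOn_linearMapAt e (s i)).comp
        ((contMDiffOn_chart_symm (I := 𝓘(ℝ, E)) (n := ∞)).mono fun y hy => (hball hy).1)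
        fun y hy => (hball hy).2
    have h2 : ContDiffOn ℝ 1 (fun p : E × (F →L[ℝ] ℝ) =>
        e.linearMapAt ℝ (χ.symm p.1) (s i (χ.symm p.1))) (Metric.ball (χ x₀) r ×ˢ univ) :=
      (h1.of_le (by exact_mod_cast le_top)).comp contDiff_fst.contDiffOn fun p hp => hp.1
    exact contDiff_snd.contDiffOn.clm_apply h2
  refine ⟨χ.source ∩ χ ⁻¹' Metric.ball (χ x₀) r,
    (χ.isOpen_inter_preimage Metric.isOpen_ball).mem_nhds
      ⟨mem_chart_source E x₀, Metric.mem_ball_self hr⟩, ?_⟩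
  calc _ ≤ dimH (f '' (Metric.ball (χ x₀) r ×ˢ univ)) := by
        refine dimH_mono ?_
        rintro c ⟨x, ⟨hx, hxr⟩, φ, hc⟩
        refine ⟨(χ x, LinearMap.toContinuousLinearMap (φ ∘ₗ e.symmₗ ℝ x)), ⟨hxr, mem_univ _⟩, ?_⟩
        ext i
        have hxe : x ∈ e.baseSet := by
          have := (hball hxr).2
          rwa [mem_preimage, χ.left_inv hx] at this
        have key : ∀ y, y = x →
            φ (e.symmₗ ℝ x (e.linearMapAt ℝ y (s i y))) = φ (s i x) := by
          rintro _ rfl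
          rw [e.symmₗ_linearMapAt hxe]
        exact (key _ (χ.left_inv hx)).trans (hc i).symm
    _ ≤ dimH (Metric.ball (χ x₀) r ×ˢ (univ : Set (F →L[ℝ] ℝ))) :=
        hf.dimH_image_le ((convex_ball _ _).prod convex_univ) subset_rfl
    _ ≤ dimH (univ : Set (E × (F →L[ℝ] ℝ))) := dimH_mono (subset_univ _)
    _ = _ := by
        rw [Real.dimH_univ_eq_finrank, finrank_prod,
          ← (LinearMap.toContinuousLinearMap : (F →ₗ[ℝ] ℝ) ≃ₗ[ℝ] (F →L[ℝ] ℝ)).finrank_eq,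
          Subspace.dual_finrank_eq]

/-- Among more than `dim M + rank V + 1` spanning sections, one can be dropped after a generic
change of the others. -/
theorem exists_spansAt_pred {m : ℕ} (hm : finrank ℝ E + finrank ℝ F < m) {K : Set M}
    {s : Fin (m + 1) → Cₛ^∞⟮𝓘(ℝ, E); F, V⟯} (hs : ∀ x ∈ K, SpansAt s x) :
    ∃ t : Fin m → Cₛ^∞⟮𝓘(ℝ, E); F, V⟯, ∀ x ∈ K, SpansAt t x := by
  choose U hU hdim using exists_nhds_dimH_le fun i : Fin m => s i.castSucc
  obtain ⟨S, hS, hcov⟩ := countable_cover_nhds_of_sigmaCompact hU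
  have hd : dimH (⋃ x₀ ∈ S, {c : Fin m → ℝ | ∃ x ∈ U x₀, ∃ φ : Dual ℝ (V x),
      ∀ i, c i = φ (s i.castSucc x)}) < finrank ℝ (Fin m → ℝ) := by
    rw [dimH_bUnion hS]
    refine (iSup₂_le fun x _ => hdim x).trans_lt ?_
    rw [finrank_fin_fun]
    exact_mod_cast hm
  obtain ⟨c, hc⟩ := (dense_compl_of_dimH_lt_finrank hd).nonempty
  refine ⟨fun i => s i.castSucc - c i • s (Fin.last m), fun x hx => ?_⟩
  by_contra hspan
  obtain ⟨φ, hφ, hle⟩ := Submodule.exists_le_ker_of_lt_top _ (lt_top_iff_ne_top.2 hspan)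
  have hi : ∀ i : Fin m, φ (s i.castSucc x) = c i * φ (s (Fin.last m) x) := fun i => by
    have : (s i.castSucc - c i • s (Fin.last m)) x ∈ LinearMap.ker φ :=
      hle (Submodule.subset_span ⟨i, rfl⟩)
    rw [LinearMap.mem_ker] at this
    change φ (s i.castSucc x - c i • s (Fin.last m) x) = 0 at this
    rwa [map_sub, map_smul, sub_eq_zero] at this
  by_cases h0 : φ (s (Fin.last m) x) = 0
  · refine hφ (LinearMap.ker_eq_top.1 (eq_top_iff.2 ((hs x hx).ge.trans (Submodule.span_le.2 ?_))))
    rintro _ ⟨i, rfl⟩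
    refine Fin.lastCases ?_ (fun i => ?_) i
    · exact h0
    · simp [hi, h0]
  · obtain ⟨x₀, hx₀, hxU⟩ : ∃ x₀ ∈ S, x ∈ U x₀ := by simpa using hcov.ge (mem_univ x)
    refine hc (mem_biUnion hx₀ ⟨x, hxU, (φ (s (Fin.last m) x))⁻¹ • φ, fun i => ?_⟩)
    simp [hi]
    field_simp

theorem exists_spansAt_bounded {m : ℕ} {K : Set M}
    {s : Fin m → Cₛ^∞⟮𝓘(ℝ, E); F, V⟯} (hs : ∀ x ∈ K, SpansAt s x) :
    ∃ t : Fin (finrank ℝ E + finrank ℝ F + 1) → Cₛ^∞⟮𝓘(ℝ, E); F, V⟯, ∀ x ∈ K, SpansAt t x := by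
  induction m with
  | zero =>
    refine ⟨fun _ => 0, fun x hx => ?_⟩
    rw [SpansAt, eq_top_iff]
    refine (hs x hx).ge.trans ?_
    simp
  | succ m ih =>
    by_cases hm : finrank ℝ E + finrank ℝ F < m
    · obtain ⟨t, ht⟩ := exists_spansAt_pred hm hs
      exact ih ht
    · refine ⟨fun i => if h : (i : ℕ) < m + 1 then s ⟨i, h⟩ else 0, fun x hx => ?_⟩
      rw [SpansAt, eq_top_iff]
      refine (hs x hx).ge.trans (Submodule.span_mono ?_)
      rintro _ ⟨i, rfl⟩
      exact ⟨⟨i, by omega⟩, by simp [Nat.lt_succ_iff.1 i.2]⟩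

end Spanning

section SerreSwan

open Set Filter Topology Module

variable {E : Type*} [NormedAddCommGroup E] [NormedSpace ℝ E] [FiniteDimensional ℝ E]
  {M : Type*} [TopologicalSpace M] [ChartedSpace E M] [IsManifold 𝓘(ℝ, E) ∞ M]
  [T2Space M] [SigmaCompactSpace M]
  {F : Type*} [NormedAddCommGroup F] [NormedSpace ℝ F] [FiniteDimensional ℝ F]
  {V : M → Type*} [TopologicalSpace (TotalSpace F V)] [∀ x, TopologicalSpace (V x)]
  [∀ x, AddCommGroup (V x)] [∀ x, Module ℝ (V x)] [FiberBundle F V] [VectorBundle ℝ F V]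
  [ContMDiffVectorBundle ∞ F V 𝓘(ℝ, E)]

/-- The section `∑ ρ_k s_k`. -/
def glueSections (ρ : SmoothPartitionOfUnity ℕ 𝓘(ℝ, E) M)
    (s : ℕ → Cₛ^∞⟮𝓘(ℝ, E); F, V⟯) : Cₛ^∞⟮𝓘(ℝ, E); F, V⟯ where
  toFun x := ∑ᶠ k, ρ k x • s k x
  contMDiff_toFun := by
    refine ContMDiff.finsum_section_of_locallyFinite (t := fun k x => ρ k x • s k x) ?_ fun k =>
      ContMDiff.smul_section (ρ k).contMDiff (s k).contMDiff
    exact ρ.locallyFinite.subset fun k x hx => left_ne_zero_of_smul hx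

theorem glueSections_apply (ρ : SmoothPartitionOfUnity ℕ 𝓘(ℝ, E) M)
    (s : ℕ → Cₛ^∞⟮𝓘(ℝ, E); F, V⟯) {x : M} {k : ℕ} (h : ∀ l, l ≠ k → ρ l x ≠ 0 → s l x = 0) :
    glueSections ρ s x = ρ k x • s k x := by
  refine finsum_eq_single _ k fun l hl => ?_
  by_cases h0 : ρ l x = 0
  · rw [h0, zero_smul]
  · rw [h l hl h0, smul_zero]

/-- Finitely many sections span all fibres. -/
theorem exists_spansAt : ∃ s : ZMod 2 × Fin (finrank ℝ E + finrank ℝ F + 1) →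
    Cₛ^∞⟮𝓘(ℝ, E); F, V⟯, ∀ x, SpansAt s x := by
  have : LocallyCompactSpace M := ChartedSpace.locallyCompactSpace E M
  let K : CompactExhaustion M := (CompactExhaustion.choice M).shiftr
  have hcompact : ∀ k, ∃ t : Fin (finrank ℝ E + finrank ℝ F + 1) → Cₛ^∞⟮𝓘(ℝ, E); F, V⟯,
      ∀ x ∈ K k, SpansAt t x := fun k => by
    obtain ⟨m, s, hs⟩ := exists_spansAt_of_isCompact (E := E) (F := F) (V := V) (K.isCompact k)
    exact exists_spansAt_bounded hs
  choose t ht using hcompact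
  let U : ℕ → Set M := fun k => interior (K (k + 2)) \ K k
  obtain ⟨ρ, hρ⟩ : ∃ ρ : SmoothPartitionOfUnity ℕ 𝓘(ℝ, E) M, ρ.IsSubordinate U := by
    refine SmoothPartitionOfUnity.exists_isSubordinate 𝓘(ℝ, E) isClosed_univ U
      (fun k => isOpen_interior.sdiff (K.isCompact k).isClosed) fun x _ => ?_
    have hx := (CompactExhaustion.choice M).mem_sdiff_shiftr_find x
    exact mem_iUnion.2 ⟨_, K.subset_interior_succ _ hx.1, hx.2⟩
  have hsupp : ∀ k x, ρ k x ≠ 0 → x ∈ U k := fun k x h => hρ k (subset_tsupport _ h)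
  have hdisj : ∀ k l x, ρ k x ≠ 0 → ρ l x ≠ 0 → (k : ZMod 2) = l → k = l := by
    intro k l x hk hl hkl
    rw [ZMod.natCast_eq_natCast_iff'] at hkl
    have h1 : l < k + 2 := by
      by_contra h
      exact (hsupp l x hl).2 (K.subset (not_lt.1 h) (interior_subset (hsupp k x hk).1))
    have h2 : k < l + 2 := by
      by_contra h
      exact (hsupp k x hk).2 (K.subset (not_lt.1 h) (interior_subset (hsupp l x hl).1))
    omega
  refine ⟨fun p => glueSections ρ fun k => if (k : ZMod 2) = p.1 then t (k + 2) p.2 else 0,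
    fun x => ?_⟩
  obtain ⟨k, hk⟩ : ∃ k, ρ k x ≠ 0 := by
    by_contra! h
    have := ρ.sum_eq_one (mem_univ x)
    simp [h] at this
  rw [SpansAt, eq_top_iff]
  refine (ht (k + 2) x (interior_subset (hsupp k x hk).1)).ge.trans (Submodule.span_le.2 ?_)
  rintro _ ⟨i, rfl⟩
  have hi : ρ k x • t (k + 2) i x ∈ Submodule.span ℝ (range fun p : ZMod 2 × Fin _ =>
      glueSections ρ (fun k => if (k : ZMod 2) = p.1 then t (k + 2) p.2 else 0) x) := by
    refine Submodule.subset_span ⟨(k, i), ?_⟩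
    dsimp only
    rw [glueSections_apply (k := k)]
    · simp
    · intro l hl hl0
      rw [if_neg fun h => hl (hdisj l k x hl0 hk h)]
      rfl
  simpa [smul_smul, inv_mul_cancel₀ hk] using Submodule.smul_mem _ (ρ k x)⁻¹ hi

/-- Near each point, spanning sections have smooth coefficient functions. -/
theorem exists_local_coefficients {ι : Type*} [Fintype ι] {s : ι → Cₛ^∞⟮𝓘(ℝ, E); F, V⟯} {x₀ : M}
    (hs : SpansAt s x₀) : ∃ U : Set M, IsOpen U ∧ x₀ ∈ U ∧ ∃ c : ∀ x, V x →ₗ[ℝ] (ι → ℝ),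
      (∀ x ∈ U, ∀ v, ∑ i, c x v i • s i x = v) ∧
      ∀ g : Cₛ^∞⟮𝓘(ℝ, E); F, V⟯, ∀ i, ContMDiffOn 𝓘(ℝ, E) 𝓘(ℝ) ∞ (fun x => c x (g x) i) U := by
  classical
  let e := trivializationAt F V x₀
  have hx₀ : x₀ ∈ e.baseSet := mem_baseSet_trivializationAt F V x₀
  let a : M → (ι → ℝ) →L[ℝ] F := fun x =>
    ∑ i, (ContinuousLinearMap.proj (R := ℝ) i).smulRight (e.linearMapAt ℝ x (s i x))
  have ha : ∀ x c, a x c = ∑ i, c i • e.linearMapAt ℝ x (s i x) := fun x c => by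
    simp [a]
  have ha_smooth : ContMDiffOn 𝓘(ℝ, E) 𝓘(ℝ, (ι → ℝ) →L[ℝ] F) ∞ a e.baseSet := by
    refine contMDiffOn_finsetSum fun i _ => ?_
    exact ((ContinuousLinearMap.smulRightL ℝ (ι → ℝ) F
      (ContinuousLinearMap.proj (R := ℝ) i)).contMDiff (n := ∞)).comp_contMDiffOn
      (contMDiffOn_linearMapAt e (s i))
  have hsurj : Function.Surjective (a x₀) := by
    intro y
    have : e.symmₗ ℝ x₀ y ∈ Submodule.span ℝ (range fun i => s i x₀) := by
      rw [hs]; trivial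
    obtain ⟨c, hc⟩ := (Submodule.mem_span_range_iff_exists_fun ℝ).1 this
    refine ⟨c, ?_⟩
    rw [ha, ← e.linearMapAt_symmₗ (R := ℝ) hx₀ y, ← hc]
    simp
  obtain ⟨r, hr⟩ := (a x₀ : (ι → ℝ) →ₗ[ℝ] F).exists_rightInverse_of_surjective
    (LinearMap.range_eq_top.2 hsurj)
  let r' : F →L[ℝ] (ι → ℝ) := LinearMap.toContinuousLinearMap r
  let b : M → F →L[ℝ] F := fun x => (a x).comp r'
  have hb_smooth : ContMDiffOn 𝓘(ℝ, E) 𝓘(ℝ, F →L[ℝ] F) ∞ b e.baseSet :=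
    ha_smooth.clm_comp contMDiffOn_const
  have hb₀ : b x₀ = 1 := by
    ext y
    exact LinearMap.congr_fun hr y
  refine ⟨e.baseSet ∩ b ⁻¹' {u | IsUnit u},
    hb_smooth.continuousOn.isOpen_inter_preimage e.open_baseSet Units.isOpen,
    ⟨hx₀, by simp [hb₀]⟩, fun x => r ∘ₗ (Ring.inverse (b x) : F →L[ℝ] F) ∘ₗ e.linearMapAt ℝ x, ?_, ?_⟩
  · rintro x ⟨hxe, hxu⟩ v
    have hinj : Function.Injective (e.linearMapAt ℝ x) := fun v w h => by
      rw [← e.symmₗ_linearMapAt (R := ℝ) hxe v, h, e.symmₗ_linearMapAt hxe]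
    apply hinj
    have := congrArg (fun u : F →L[ℝ] F => u (e.linearMapAt ℝ x v)) (Ring.mul_inverse_cancel (b x) hxu)
    simp only [map_sum, map_smul]
    rw [← ha]
    exact this
  · intro g i
    have h1 : ContMDiffOn 𝓘(ℝ, E) 𝓘(ℝ, F →L[ℝ] F) ∞ (fun x => Ring.inverse (b x))
        (e.baseSet ∩ b ⁻¹' {u | IsUnit u}) := by
      rintro x ⟨hxe, u, hu⟩
      have h2 : ContMDiffAt 𝓘(ℝ, F →L[ℝ] F) 𝓘(ℝ, F →L[ℝ] F) ∞ Ring.inverse (b x) := by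
        rw [← hu]; exact (contDiffAt_ringInverse ℝ u).contMDiffAt
      exact h2.comp_contMDiffWithinAt x ((hb_smooth x hxe).mono inter_subset_left)
    have h3 := h1.clm_apply ((contMDiffOn_linearMapAt e g).mono inter_subset_left)
    exact (((ContinuousLinearMap.proj (R := ℝ) i).comp r').contMDiff (n := ∞)).comp_contMDiffOn h3

/-- Sections that span all fibres have coefficient functionals. -/
theorem exists_coefficients {ι : Type*} [Fintype ι] {s : ι → Cₛ^∞⟮𝓘(ℝ, E); F, V⟯}
    (hs : ∀ x, SpansAt s x) :
    ∃ τ : ι → Dual C^∞⟮𝓘(ℝ, E), M; ℝ⟯ Cₛ^∞⟮𝓘(ℝ, E); F, V⟯, ∀ g, ∑ i, τ i g • s i = g := by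
  choose U hU hxU c hc hsmooth using fun x₀ => exists_local_coefficients (hs x₀)
  obtain ⟨ρ, hρ⟩ := SmoothPartitionOfUnity.exists_isSubordinate 𝓘(ℝ, E) isClosed_univ U hU
    fun x _ => mem_iUnion.2 ⟨x, hxU x⟩
  have hfin : ∀ x, (Function.support fun k => ρ k x).Finite := fun x =>
    ρ.locallyFinite.point_finite x
  have hfin' : ∀ x (v : V x) i, (Function.support fun k => ρ k x • c k x v i).Finite :=
    fun x v i => (hfin x).subset fun k hk => left_ne_zero_of_smul hk
  let τ : ι → Dual C^∞⟮𝓘(ℝ, E), M; ℝ⟯ Cₛ^∞⟮𝓘(ℝ, E); F, V⟯ := fun i =>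
    { toFun := fun g => ⟨fun x => ∑ᶠ k, ρ k x • c k x (g x) i,
        hρ.contMDiff_finsum_smul hU fun k => hsmooth k g i⟩
      map_add' := fun g h => by
        ext x
        change ∑ᶠ k, ρ k x • c k x ((g + h) x) i =
          (∑ᶠ k, ρ k x • c k x (g x) i) + ∑ᶠ k, ρ k x • c k x (h x) i
        rw [← finsum_add_distrib (hfin' x _ i) (hfin' x _ i)]
        simp [mul_add]
      map_smul' := fun r g => by
        ext x
        change ∑ᶠ k, ρ k x • c k x ((r • g) x) i = r x * ∑ᶠ k, ρ k x • c k x (g x) i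
        refine Eq.trans ?_ (mul_finsum _ _).symm
        refine finsum_congr fun k => ?_
        rw [section_smul_apply, map_smul, Pi.smul_apply, smul_eq_mul, smul_eq_mul, smul_eq_mul]
        ring }
  refine ⟨τ, fun g => ContMDiffSection.ext fun x => ?_⟩
  have h1 : (∑ i, τ i g • s i) x = ∑ i, (∑ᶠ k, ρ k x • c k x (g x) i) • s i x := by
    rw [← ContMDiffSection.coeAddHom_apply, map_sum, Finset.sum_apply]
    rfl
  have h2 : ∀ k, ρ k x • g x = ∑ i, (ρ k x • c k x (g x) i) • s i x := fun k => by
    by_cases h0 : ρ k x = 0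
    · simp [h0]
    · simp only [smul_assoc]
      rw [← Finset.smul_sum, hc k x (hρ k (subset_tsupport _ h0))]
  rw [h1]
  calc ∑ i, (∑ᶠ k, ρ k x • c k x (g x) i) • s i x
      = ∑ i, ∑ᶠ k, (ρ k x • c k x (g x) i) • s i x := by
        refine Finset.sum_congr rfl fun i _ => finsum_smul' (hfin' x _ i) _
    _ = ∑ᶠ k, ∑ i, (ρ k x • c k x (g x) i) • s i x := by
        refine (finsum_sum_comm _ _ fun i _ => ?_).symm
        exact (hfin' x (g x) i).subset fun k hk => left_ne_zero_of_smul hk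
    _ = ∑ᶠ k, ρ k x • g x := finsum_congr fun k => (h2 k).symm
    _ = (∑ᶠ k, ρ k x) • g x := (finsum_smul' (hfin x) _).symm
    _ = g x := by rw [ρ.sum_eq_one (mem_univ x), one_smul]

/-- Sections of a vector bundle form a finitely generated module. -/
instance finite_sections : Module.Finite C^∞⟮𝓘(ℝ, E), M; ℝ⟯ Cₛ^∞⟮𝓘(ℝ, E); F, V⟯ := by
  classical
  obtain ⟨s, hs⟩ := exists_spansAt (E := E) (M := M) (F := F) (V := V)
  obtain ⟨τ, hτ⟩ := exists_coefficients hs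
  refine ⟨Finset.univ.image s, eq_top_iff.2 fun g _ => ?_⟩
  rw [← hτ g]
  exact sum_mem fun i _ => Submodule.smul_mem _ _ (Submodule.subset_span (by simp))

/-- Sections of a vector bundle form a projective module. -/
instance projective_sections :
    Module.Projective C^∞⟮𝓘(ℝ, E), M; ℝ⟯ Cₛ^∞⟮𝓘(ℝ, E); F, V⟯ := by
  obtain ⟨s, hs⟩ := exists_spansAt (E := E) (M := M) (F := F) (V := V)
  obtain ⟨τ, hτ⟩ := exists_coefficients hs
  refine .of_split (LinearMap.pi τ) (Fintype.linearCombination _ s) (LinearMap.ext fun g => ?_)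
  simp [Fintype.linearCombination_apply, hτ]

end SerreSwan

end LieTwo

end

theorem mainTheorem7
    -- a smooth manifold `M`
    {E : Type*} [NormedAddCommGroup E] [NormedSpace ℝ E] [FiniteDimensional ℝ E]
    {M : Type*} [TopologicalSpace M] [ChartedSpace E M] [IsManifold 𝓘(ℝ, E) ∞ M]
    [T2Space M] [SigmaCompactSpace M]
    -- a Lie 2-algebroid over `M`: the graded algebra `𝒜` of functions of a `[2]`-manifold (which
    -- has splittings, see below) and a homological vector field on it
    {A : Type*} [Ring A] [Algebra ℝ A] [Algebra C^∞⟮𝓘(ℝ, E), M; ℝ⟯ A]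
    [IsScalarTower ℝ C^∞⟮𝓘(ℝ, E), M; ℝ⟯ A]
    (𝒜 : ℤ → Submodule C^∞⟮𝓘(ℝ, E), M; ℝ⟯ A) [GradedAlgebra 𝒜]
    (Q : LieTwo.HomologicalVectorField 𝒜)
    -- smooth vector bundles `VQ` and `VB` over `M`, for the splittings `VQ[1] ⊕ VB[2]`
    {FQ : Type*} [NormedAddCommGroup FQ] [NormedSpace ℝ FQ] [FiniteDimensional ℝ FQ]
    (VQ : M → Type*) [TopologicalSpace (TotalSpace FQ VQ)] [∀ x, TopologicalSpace (VQ x)]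
    [∀ x, AddCommGroup (VQ x)] [∀ x, Module ℝ (VQ x)] [FiberBundle FQ VQ] [VectorBundle ℝ FQ VQ]
    [ContMDiffVectorBundle ∞ FQ VQ 𝓘(ℝ, E)]
    {FB : Type*} [NormedAddCommGroup FB] [NormedSpace ℝ FB] [FiniteDimensional ℝ FB]
    (VB : M → Type*) [TopologicalSpace (TotalSpace FB VB)] [∀ x, TopologicalSpace (VB x)]
    [∀ x, AddCommGroup (VB x)] [∀ x, Module ℝ (VB x)] [FiberBundle FB VB] [VectorBundle ℝ FB VB]
    [ContMDiffVectorBundle ∞ FB VB 𝓘(ℝ, E)]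
    -- a second such pair of vector bundles
    {FQ' : Type*} [NormedAddCommGroup FQ'] [NormedSpace ℝ FQ'] [FiniteDimensional ℝ FQ']
    (VQ' : M → Type*) [TopologicalSpace (TotalSpace FQ' VQ')] [∀ x, TopologicalSpace (VQ' x)]
    [∀ x, AddCommGroup (VQ' x)] [∀ x, Module ℝ (VQ' x)] [FiberBundle FQ' VQ']
    [VectorBundle ℝ FQ' VQ'] [ContMDiffVectorBundle ∞ FQ' VQ' 𝓘(ℝ, E)]
    {FB' : Type*} [NormedAddCommGroup FB'] [NormedSpace ℝ FB'] [FiniteDimensional ℝ FB']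
    (VB' : M → Type*) [TopologicalSpace (TotalSpace FB' VB')] [∀ x, TopologicalSpace (VB' x)]
    [∀ x, AddCommGroup (VB' x)] [∀ x, Module ℝ (VB' x)] [FiberBundle FB' VB']
    [VectorBundle ℝ FB' VB'] [ContMDiffVectorBundle ∞ FB' VB' 𝓘(ℝ, E)] :
    -- a splitting and connections determine an adjoint representation
    (∀ (S : LieTwo.Splitting Cₛ^∞⟮𝓘(ℝ, E); FQ, VQ⟯ Cₛ^∞⟮𝓘(ℝ, E); FB, VB⟯ 𝒜)
      (D₁ : LieTwo.Connection C^∞⟮𝓘(ℝ, E), M; ℝ⟯ Cₛ^∞⟮𝓘(ℝ, E); FQ, VQ⟯)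
      (D₂ : LieTwo.Connection C^∞⟮𝓘(ℝ, E), M; ℝ⟯ Cₛ^∞⟮𝓘(ℝ, E); FB, VB⟯),
      Function.Injective (LieTwo.adMap S D₁ D₂) ∧
      LinearMap.range (LieTwo.adMap S D₁ D₂) = LieTwo.vectorFields 𝒜 ∧
      (∀ p w, LieTwo.IsVectorField 𝒜 p (LieTwo.adMap S D₁ D₂ w) ↔
        w ∈ LieTwo.totalDegree 𝒜 (LieTwo.adGrading C^∞⟮𝓘(ℝ, E), M; ℝ⟯
          Cₛ^∞⟮𝓘(ℝ, E); FQ, VQ⟯ Cₛ^∞⟮𝓘(ℝ, E); FB, VB⟯) p) ∧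
      ∃! ρ : LieTwo.RepUpToHomotopy Q (LieTwo.adGrading C^∞⟮𝓘(ℝ, E), M; ℝ⟯
          Cₛ^∞⟮𝓘(ℝ, E); FQ, VQ⟯ Cₛ^∞⟮𝓘(ℝ, E); FB, VB⟯),
        LieTwo.IsAdjointRep S D₁ D₂ ρ) ∧
    -- change of splitting, with the same connections: the isomorphism from the first adjoint
    -- representation to the second is `β ↦ β`, `q ↦ q - σ(q, ·)`, `X ↦ X - ∇_X σ`, its inverse is
    -- `β ↦ β`, `q ↦ q + σ(q, ·)`, `X ↦ X + ∇_X σ`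
    (∀ (S₁ S₂ : LieTwo.Splitting Cₛ^∞⟮𝓘(ℝ, E); FQ, VQ⟯ Cₛ^∞⟮𝓘(ℝ, E); FB, VB⟯ 𝒜)
      (σ : LieTwo.TwoForm C^∞⟮𝓘(ℝ, E), M; ℝ⟯ Cₛ^∞⟮𝓘(ℝ, E); FQ, VQ⟯ Cₛ^∞⟮𝓘(ℝ, E); FB, VB⟯),
      LieTwo.IsChangeOfSplitting S₁ S₂ σ →
      ∀ (D₁ : LieTwo.Connection C^∞⟮𝓘(ℝ, E), M; ℝ⟯ Cₛ^∞⟮𝓘(ℝ, E); FQ, VQ⟯)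
        (D₂ : LieTwo.Connection C^∞⟮𝓘(ℝ, E), M; ℝ⟯ Cₛ^∞⟮𝓘(ℝ, E); FB, VB⟯)
        (ρ₁ ρ₂ : LieTwo.RepUpToHomotopy Q (LieTwo.adGrading C^∞⟮𝓘(ℝ, E), M; ℝ⟯
          Cₛ^∞⟮𝓘(ℝ, E); FQ, VQ⟯ Cₛ^∞⟮𝓘(ℝ, E); FB, VB⟯)),
        LieTwo.IsAdjointRep S₁ D₁ D₂ ρ₁ → LieTwo.IsAdjointRep S₂ D₁ D₂ ρ₂ →
        ∃ e : LieTwo.RepIso ρ₁ ρ₂,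
          (∀ w, e.toEquiv w = LieTwo.changeMap S₁ D₁ D₂ (-σ) w) ∧
          (∀ w, e.toEquiv.symm w = LieTwo.changeMap S₁ D₁ D₂ σ w) ∧
          ∀ w, LieTwo.adMap S₂ D₁ D₂ (e.toEquiv w) = LieTwo.adMap S₁ D₁ D₂ w) ∧
    -- the isomorphism class does not depend on the choices
    (∀ (S : LieTwo.Splitting Cₛ^∞⟮𝓘(ℝ, E); FQ, VQ⟯ Cₛ^∞⟮𝓘(ℝ, E); FB, VB⟯ 𝒜)
      (D₁ : LieTwo.Connection C^∞⟮𝓘(ℝ, E), M; ℝ⟯ Cₛ^∞⟮𝓘(ℝ, E); FQ, VQ⟯)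
      (D₂ : LieTwo.Connection C^∞⟮𝓘(ℝ, E), M; ℝ⟯ Cₛ^∞⟮𝓘(ℝ, E); FB, VB⟯)
      (ρ : LieTwo.RepUpToHomotopy Q (LieTwo.adGrading C^∞⟮𝓘(ℝ, E), M; ℝ⟯
          Cₛ^∞⟮𝓘(ℝ, E); FQ, VQ⟯ Cₛ^∞⟮𝓘(ℝ, E); FB, VB⟯))
      (S' : LieTwo.Splitting Cₛ^∞⟮𝓘(ℝ, E); FQ', VQ'⟯ Cₛ^∞⟮𝓘(ℝ, E); FB', VB'⟯ 𝒜)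
      (D₁' : LieTwo.Connection C^∞⟮𝓘(ℝ, E), M; ℝ⟯ Cₛ^∞⟮𝓘(ℝ, E); FQ', VQ'⟯)
      (D₂' : LieTwo.Connection C^∞⟮𝓘(ℝ, E), M; ℝ⟯ Cₛ^∞⟮𝓘(ℝ, E); FB', VB'⟯)
      (ρ' : LieTwo.RepUpToHomotopy Q (LieTwo.adGrading C^∞⟮𝓘(ℝ, E), M; ℝ⟯
          Cₛ^∞⟮𝓘(ℝ, E); FQ', VQ'⟯ Cₛ^∞⟮𝓘(ℝ, E); FB', VB'⟯)),
      LieTwo.IsAdjointRep S D₁ D₂ ρ → LieTwo.IsAdjointRep S' D₁' D₂' ρ' →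
      Nonempty (LieTwo.RepIso ρ ρ')) := by
  exact ⟨fun S D₁ D₂ => ⟨LieTwo.adMap_injective S D₁ D₂, LieTwo.range_adMap S D₁ D₂,
      LieTwo.isVectorField_adMap_iff S D₁ D₂, LieTwo.existsUnique_adjointRep S D₁ D₂ Q⟩,
    fun _ _ _ h D₁ D₂ _ _ h₁ h₂ => h.exists_repIso D₁ D₂ h₁ h₂,
    fun S D₁ D₂ _ S' D₁' D₂' _ hρ hρ' =>
      ⟨(LieTwo.exists_repIso S D₁ D₂ S' D₁' D₂' hρ hρ').choose⟩⟩
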